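/- **Setting.** Let $\Omega\subset\mathbb R^d$ be compact (with Lebesgue measure), $1\le p,q\le\infty$, and let $\mathcal T:L^p(\Omega;\mathbb R^{c_{\rm in}})\to L^q(\Omega;\mathbb R^{c_{\rm out}})$ be a map that is continuous on bounded sets. **The pipeline.** A Gaussian particle operator $\mathcal G_\Theta$ with modal budget $G\ge 1$ acts on $a:\Omega\to\mathbb R^{c_{\rm in}}$ as follows, where $\mathrm{ReLU}(t)=\max(t,0)$ and $\mathrm{Softplus}(t)=\log(1+e^t)$ act coordinatewise and all widths, the token dimension $D\ge1$, the number of heads $H\ge1$, the number of stages $n\ge1$ and all real matrices are free parameters in $\Theta$. 1. *Encoder.* With $\gamma(x)=[\sin(2\pi Bx),\cos(2\pi Bx)]$ for a real matrix $B$ with $d$ columns, put $\phi(x)=\mathrm{ReLU}(W_{\rm in}[a(x),\gamma(x)])$, $\mu=W_\mu\mathrm{ReLU}(U_\mu\phi)$, $\sigma=\mathrm{Softplus}(W_\sigma\mathrm{ReLU}(U_\sigma\phi))$, $w=\mathrm{Softmax}(W_w\mathrm{ReLU}(U_w\phi))$, giving $\mu_i(x),\sigma_i(x)\in\mathbb R^d$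 and $w_i(x)\in[0,1]$ for $i=1,\dots,G$. The initial coefficients are $z^{(0)}_i(x)=w_i(x)\exp\!\big(-\tfrac12\|(x-\mu_i(x))/\sigma_i(x)\|_2^2\big)$, the division being coordinatewise. 2. *Petrov–Galerkin Gaussian attention.* One stage sends a coefficient field $z:\Omega\to\mathbb R^G$ to $z'$ as follows. For each head $h$, the windows are $p^{(h)}(x,\cdot)=\mathrm{Softmax}(W_p^{(h)}P^{(h)}[z,w,\mu,\sigma](x))\in\mathbb R^G$, where $P^{(h)}$ has $D$ rows. The tokens are $$t^{(h)}_g=\frac{\int_\Omega p^{(h)}(x,g)\,z(x)W_z^{(h)}\,dx}{\int_\Omega p^{(h)}(x,g)\,dx}\in\mathbb R^D,$$ the rows of a matrix $T^{(h)}\in\mathbb R^{G\times D}$. The coupled tokens are $U^{(h)}=\mathrm{Softmax}\big(T^{(h)}W_Q^{(h)}(T^{(h)}W_K^{(h)})^{\top}/\sqrt D\big)T^{(h)}W_V^{(h)}$ with row-wise softmax. The scattered field is $\tilde z(x)=\big[\sum_g p^{(h)}(x,g)U^{(h)}_g\big]_{h=1}^{H}W_{\rm out}\in\mathbb R^G$.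 With $\lambda\in[0,1]$ and $\epsilon_0>0$ (both in $\Theta$), put $\hat z=(1-\lambda)z+\lambda\tilde z$ and $z'=\dfrac{\sum_g z_g}{\sum_g\hat z_g+\epsilon_0}\,\hat z$. The same stage is applied $n$ times, giving $z^{(n)}$. 3. *Decoder.* $\mathcal G_\Theta(a)(x)=W_2\mathrm{ReLU}(W_1z^{(n)}(x)+b_1)+b_2\in\mathbb R^{c_{\rm out}}$. **Theorem.** Suppose that at least one of the following holds. * (Mercer kernel) $\mathcal Tf(x)=\int_\Omega K(x,y)f(y)\,dy$ for every $f$ and a.e. $x$, with $K:\Omega\times\Omega\to\mathbb R^{c_{\rm out}\times c_{\rm in}}$ continuous (symmetry and positivity are not needed). * (Hilbert–Schmidt kernel) $q\le 2\le p$ and $\mathcal T$ has this form with $K\in L^2(\Omega\times\Omega;\mathbb R^{c_{\rm out}\times c_{\rm in}})$. * (Low-rank factorization) $\mathcal T\approx\Phi(\cdot)\,\mathcal K\,\Phi(\cdot)^\top$ with continuous features. That is, for every bounded $S\subset L^p$ and every $\eta>0$ there are $m$, a continuous $\Phi:\Omega\to\mathbb R^m$ and an $m\times m$ array $\mathcal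 K$ of $c_{\rm out}\times c_{\rm in}$ matrices such that $\big\|\mathcal Tf-\sum_{k,l}\Phi_k(\cdot)\,\mathcal K_{kl}\int_\Omega\Phi_l(y)f(y)\,dy\big\|_{L^q}<\eta$ for all $f\in S$. Then for every bounded set $S\subset L^p(\Omega;\mathbb R^{c_{\rm in}})$ (assumed moreover totally bounded if $p=1$) and every $\varepsilon>0$ there are a modal budget $G$ and parameters $\Theta$ such that for every $f\in S$ the pipeline is well defined at $f$ (at each stage the input coefficients are integrable and the renormalization denominator is nonzero a.e.), $\mathcal G_\Theta(f)\in L^q$, and $$\sup_{f\in S}\|\mathcal G_\Theta(f)-\mathcal T f\|_{L^q(\Omega;\mathbb R^{c_{\rm out}})}<\varepsilon .$$ -/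

import Mathlib

open MeasureTheory
open scoped ENNReal

namespace GPO

/-- Euclidean space `ℝ^n`. -/
abbrev E (n : ℕ) : Type := EuclideanSpace ℝ (Fin n)

/-- Coordinatewise ReLU. -/
def relu {ι : Type*} (v : ι → ℝ) : ι → ℝ := fun i => max (v i) 0

/-- Coordinatewise softplus `t ↦ log (1 + exp t)`. -/
noncomputable def softplus {ι : Type*} (v : ι → ℝ) : ι → ℝ :=
  fun i => Real.log (1 + Real.exp (v i))

/-- Softmax of a finite family of logits. -/
noncomputable def softmax {ι : Type*} [Fintype ι] (v : ι → ℝ) : ι → ℝ :=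
  fun i => Real.exp (v i) / ∑ k, Real.exp (v k)

/-- Index set of the per-site descriptor `ξ = [z, w, μ, σ] ∈ ℝ^{G(2d+2)}`. -/
abbrev DescIdx (d G : ℕ) : Type := Fin G ⊕ Fin G ⊕ (Fin G × Fin d) ⊕ (Fin G × Fin d)

/-- All parameters of a Gaussian particle operator with modal budget `G` for fields
`Ω ⊆ ℝ^d → ℝ^cin`, with output values in `ℝ^cout`: encoder, Gaussian modal windows,
Petrov-Galerkin Gaussian attention, residual update and row renormalization, decoder.
All widths, the number of heads and the number of stages are free. -/
structure Params (d cin cout G : ℕ) where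
  /-- number of Fourier frequencies of the positional encoding -/
  freq : ℕ
  /-- frequency matrix of the positional encoding -/
  B : Matrix (Fin freq) (Fin d) ℝ
  /-- width of the shared encoder layer -/
  width : ℕ
  Win : Matrix (Fin width) (Fin cin ⊕ Fin freq ⊕ Fin freq) ℝ
  /-- widths of the hidden layers of the three encoder heads -/
  widthμ : ℕ
  widthσ : ℕ
  widthw : ℕ
  Uμ : Matrix (Fin widthμ) (Fin width) ℝ
  Wμ : Matrix (Fin G × Fin d) (Fin widthμ) ℝ
  Uσ : Matrix (Fin widthσ) (Fin width) ℝ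
  Wσ : Matrix (Fin G × Fin d) (Fin widthσ) ℝ
  Uw : Matrix (Fin widthw) (Fin width) ℝ
  Ww : Matrix (Fin G) (Fin widthw) ℝ
  /-- number of attention heads -/
  heads : ℕ
  heads_pos : 0 < heads
  /-- token dimension of a head -/
  D : ℕ
  D_pos : 0 < D
  /-- projection of the descriptor `ξ` to `ℝ^D` -/
  proj : Fin heads → Matrix (Fin D) (DescIdx d G) ℝ
  /-- projection to the window logits -/
  Wp : Fin heads → Matrix (Fin G) (Fin D) ℝ
  /-- projection of the coefficients that are measured -/
  Wz : Fin heads → Matrix (Fin G) (Fin D) ℝ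
  WQ : Fin heads → Matrix (Fin D) (Fin D) ℝ
  WK : Fin heads → Matrix (Fin D) (Fin D) ℝ
  WV : Fin heads → Matrix (Fin D) (Fin D) ℝ
  /-- read-out of the concatenated heads -/
  Wout : Matrix (Fin heads × Fin D) (Fin G) ℝ
  /-- residual mixing coefficient -/
  lam : ℝ
  lam_mem : lam ∈ Set.Icc (0 : ℝ) 1
  /-- stabilizer of the row renormalization -/
  stab : ℝ
  stab_pos : 0 < stab
  /-- number of times the Gaussian-basis operator is applied -/
  stages : ℕ
  stages_pos : 0 < stages
  /-- two-layer perceptron decoder -/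
  widthDec : ℕ
  W₁ : Matrix (Fin widthDec) (Fin G) ℝ
  b₁ : Fin widthDec → ℝ
  W₂ : Matrix (Fin cout) (Fin widthDec) ℝ
  b₂ : Fin cout → ℝ

variable {d cin cout G : ℕ}

namespace Params

/-! Encoder and evaluation of the Gaussian basis -/

/-- Fourier features `γ(x) = [sin (2π B x), cos (2π B x)]`. -/
noncomputable def fourier (Θ : Params d cin cout G) (x : E d) :
    Fin Θ.freq ⊕ Fin Θ.freq → ℝ :=
  Sum.elim (fun k => Real.sin (2 * Real.pi * Θ.B.mulVec (fun l => x l) k))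
    (fun k => Real.cos (2 * Real.pi * Θ.B.mulVec (fun l => x l) k))

/-- `φ = ReLU (W_in [v, γ(x)])` for the field value `v` at the site `x`. -/
noncomputable def hidden (Θ : Params d cin cout G) (v : E cin) (x : E d) : Fin Θ.width → ℝ :=
  relu (Θ.Win.mulVec (Sum.elim (fun i => v i) (Θ.fourier x)))

/-- Centers of the `G` particles at the site `x`. -/
noncomputable def center (Θ : Params d cin cout G) (v : E cin) (x : E d) :
    Fin G × Fin d → ℝ :=
  Θ.Wμ.mulVec (relu (Θ.Uμ.mulVec (Θ.hidden v x)))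

/-- Axis-aligned scales of the `G` particles at the site `x`. -/
noncomputable def scale (Θ : Params d cin cout G) (v : E cin) (x : E d) :
    Fin G × Fin d → ℝ :=
  softplus (Θ.Wσ.mulVec (relu (Θ.Uσ.mulVec (Θ.hidden v x))))

/-- Mixture weights of the `G` particles at the site `x`. -/
noncomputable def weight (Θ : Params d cin cout G) (v : E cin) (x : E d) : Fin G → ℝ :=
  softmax (Θ.Ww.mulVec (relu (Θ.Uw.mulVec (Θ.hidden v x))))

/-- Gaussian basis coefficients `z_i = w_i exp (-‖(x - μ_i)/σ_i‖² / 2)`. -/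
noncomputable def basis (Θ : Params d cin cout G) (v : E cin) (x : E d) : Fin G → ℝ :=
  fun i => Θ.weight v x i *
    Real.exp (-(1 / 2) * ∑ l, ((x l - Θ.center v x (i, l)) / Θ.scale v x (i, l)) ^ 2)

/-! Petrov-Galerkin Gaussian attention.

The sites are described by a measure `ν` on `ℝ^d`. For the counting measure of a finite set of
sites `x_1, …, x_N`, integrals against `ν` are the sums over the sites; Lebesgue measure on `Ω`
gives the operator on function spaces. `a` is the input field and `Z` the current field of
coefficients. -/

/-- Gaussian modal windows `p^{(h)}(x, ·) = softmax (W_p (proj ξ(x)))`, where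
`ξ = [z, w, μ, σ]`. -/
noncomputable def window (Θ : Params d cin cout G) (a : E d → E cin) (Z : E d → Fin G → ℝ)
    (h : Fin Θ.heads) (x : E d) : Fin G → ℝ :=
  softmax ((Θ.Wp h).mulVec ((Θ.proj h).mulVec
    (Sum.elim (Z x) (Sum.elim (Θ.weight (a x) x)
      (Sum.elim (Θ.center (a x) x) (Θ.scale (a x) x))))))

/-- Tokens `t_g = ∫ p_g s / ∫ p_g` with `s = z W_z`, as a `G × D` matrix. -/
noncomputable def token (Θ : Params d cin cout G) (ν : Measure (E d)) (a : E d → E cin)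
    (Z : E d → Fin G → ℝ) (h : Fin Θ.heads) : Matrix (Fin G) (Fin Θ.D) ℝ :=
  Matrix.of fun g k =>
    (∫ x, Θ.window a Z h x g * (Θ.Wz h).vecMul (Z x) k ∂ν) / ∫ x, Θ.window a Z h x g ∂ν

/-- Coupled tokens `softmax (Q Kᵀ / √D) V`, with row-wise softmax, `Q = T W_Q`, `K = T W_K`,
`V = T W_V`. -/
noncomputable def couple (Θ : Params d cin cout G) (h : Fin Θ.heads)
    (T : Matrix (Fin G) (Fin Θ.D) ℝ) : Matrix (Fin G) (Fin Θ.D) ℝ :=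
  (Matrix.of fun g => softmax fun g' =>
    ((T * Θ.WQ h) * (T * Θ.WK h).transpose) g g' / Real.sqrt Θ.D) * (T * Θ.WV h)

/-- Scatter through the same windows, concatenation of the heads and read-out. -/
noncomputable def scatter (Θ : Params d cin cout G) (ν : Measure (E d)) (a : E d → E cin)
    (Z : E d → Fin G → ℝ) (x : E d) : Fin G → ℝ :=
  Θ.Wout.vecMul fun hk =>
    ∑ g, Θ.window a Z hk.1 x g * Θ.couple hk.1 (Θ.token ν a Z hk.1) g hk.2

/-- Convex residual update. -/
noncomputable def mixed (Θ : Params d cin cout G) (ν : Measure (E d)) (a : E d → E cin)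
    (Z : E d → Fin G → ℝ) (x : E d) : Fin G → ℝ :=
  fun g => (1 - Θ.lam) * Z x g + Θ.lam * Θ.scatter ν a Z x g

/-- The Gaussian-basis operator: residual update followed by row renormalization. -/
noncomputable def stage (Θ : Params d cin cout G) (ν : Measure (E d)) (a : E d → E cin)
    (Z : E d → Fin G → ℝ) (x : E d) : Fin G → ℝ :=
  fun g => (∑ g', Z x g') / ((∑ g', Θ.mixed ν a Z x g') + Θ.stab) * Θ.mixed ν a Z x g

/-- Coefficients `Z^{(k)}` after `k` applications of the Gaussian-basis operator. -/
noncomputable def coeffs (Θ : Params d cin cout G) (ν : Measure (E d)) (a : E d → E cin)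
    (k : ℕ) : E d → Fin G → ℝ :=
  (Θ.stage ν a)^[k] fun x => Θ.basis (a x) x

/-- Pointwise two-layer ReLU decoder. -/
noncomputable def decode (Θ : Params d cin cout G) (z : Fin G → ℝ) : E cout :=
  WithLp.toLp 2 (Θ.W₂.mulVec (relu (Θ.W₁.mulVec z + Θ.b₁)) + Θ.b₂)

/-- The full pipeline applied to the field `a`, with sites distributed according to `ν`. -/
noncomputable def eval (Θ : Params d cin cout G) (ν : Measure (E d)) (a : E d → E cin)
    (x : E d) : E cout :=
  Θ.decode (Θ.coeffs ν a Θ.stages x)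

/-- Every integral and every quotient in the pipeline is a genuine one: at each stage the
coefficients are integrable and the denominator of the row renormalization does not vanish. -/
def WellDefinedAt (Θ : Params d cin cout G) (ν : Measure (E d)) (a : E d → E cin) : Prop :=
  ∀ k < Θ.stages,
    (∀ g, Integrable (fun x => Θ.coeffs ν a k x g) ν) ∧
    ∀ᵐ x ∂ν, (∑ g, Θ.mixed ν a (Θ.coeffs ν a k) x g) + Θ.stab ≠ 0

end Params

/-! Operators with a kernel or a low-rank factorization -/

section Operators

variable {p q : ℝ≥0∞} {Ω : Set (E d)}

/-- `T f (x) = ∫_Ω K(x, y) f(y) dy` with a matrix-valued kernel `K`. -/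
def IsIntegralOperator (K : E d → E d → E cin →L[ℝ] E cout)
    (T : Lp (E cin) p (volume.restrict Ω) → Lp (E cout) q (volume.restrict Ω)) : Prop :=
  ∀ f, ∀ᵐ x ∂volume.restrict Ω, T f x = ∫ y in Ω, K x y (f y)

/-- Integral operators with continuous kernel on `Ω × Ω`. Mercer kernels are those that are
moreover symmetric and positive semidefinite. -/
def HasContinuousKernel
    (T : Lp (E cin) p (volume.restrict Ω) → Lp (E cout) q (volume.restrict Ω)) : Prop :=
  ∃ K : E d → E d → E cin →L[ℝ] E cout,
    ContinuousOn (Function.uncurry K) (Ω ×ˢ Ω) ∧ IsIntegralOperator K T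

/-- Integral operators with Hilbert-Schmidt kernel, that is, with kernel in `L²(Ω × Ω)`. -/
def HasHilbertSchmidtKernel
    (T : Lp (E cin) p (volume.restrict Ω) → Lp (E cout) q (volume.restrict Ω)) : Prop :=
  ∃ K : E d → E d → E cin →L[ℝ] E cout,
    MemLp (Function.uncurry K) 2 ((volume.restrict Ω).prod (volume.restrict Ω)) ∧
    IsIntegralOperator K T

/-- The operator `f ↦ Φ(x) 𝒦 ∫_Ω Φ(y)ᵀ f(y) dy` with features `Φ : Ω → ℝ^m`. The entries of the
`m × m` coupling `𝒦` are themselves `cout × cin` matrices. -/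
noncomputable def lowRank {m : ℕ} (Ω : Set (E d)) (Φ : E d → E m)
    (𝒦 : Fin m → Fin m → E cin →L[ℝ] E cout) (f : E d → E cin) (x : E d) : E cout :=
  ∑ k, ∑ l, Φ x k • 𝒦 k l (∫ y in Ω, Φ y l • f y)

/-- `T ≈ Φ 𝒦 Φᵀ` with continuous features: uniformly on each bounded set, `T` is approximated
to any accuracy by such operators. -/
def HasLowRankFactorization [Fact (1 ≤ p)]
    (T : Lp (E cin) p (volume.restrict Ω) → Lp (E cout) q (volume.restrict Ω)) : Prop :=
  ∀ S : Set (Lp (E cin) p (volume.restrict Ω)), Bornology.IsBounded S → ∀ η : ℝ, 0 < η →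
    ∃ (m : ℕ) (Φ : E d → E m) (𝒦 : Fin m → Fin m → E cin →L[ℝ] E cout),
      ContinuousOn Φ Ω ∧
      ∀ f ∈ S, eLpNorm (fun x => T f x - lowRank Ω Φ 𝒦 f x) q (volume.restrict Ω)
        < ENNReal.ofReal η

end Operators

end GPO

/-!
Why the theorem holds. Each hypothesis on `T` makes `T` a limit, uniformly on bounded sets, of
separable operators `f ↦ ∑ t, (∫_Ω b t · f_{j t}) A t` with continuous `b t`, `A t`
(`GPO.exists_sepOp_approx`): a continuous kernel is uniformly close to a sum of products
`exp ⟨a₁, x⟩ exp ⟨a₂, y⟩` by Stone-Weierstrass, and a Hilbert-Schmidt kernel is close in `L²` to a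
continuous one. It remains to realize a separable operator by a pipeline, uniformly over `S`.

One stage with one head suffices. With uniform windows and uniform attention weights all coupled
tokens equal the mean over `Ω` of the initial coefficients, so the stage computes the coefficients
`z_i (x)` together with their means: each channel is used twice, and the read-out adds its mean to
one copy and subtracts it from the other. Since the read-out is balanced, the renormalization is
multiplication by an explicit function of `x`, which is positive and bounded below on `Ω`
(`GPO.Channels.stage_params`). The decoder therefore sees, up to that factor, `z_i (x)` and
`⨍ z_i`, and it only has to approximate a sum of products of linear forms in these numbers; ReLU
networks do so because products reduce to squares and squares are limits of sums of ReLUs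
(`GPO.exists_relu_approx_bilinear`).

What is left is the expressivity of the initial coefficients. With centers `0` and constant scales
these are a fixed Gaussian factor times a softmax whose logits are affine in the truncated values
`clip_M (f x)` and in `sin (2 π η x)`. Exponentials of affine functions of these features span a
dense algebra, and a dominating reference channel turns the softmax into such exponentials up to a
small relative error (`GPO.exists_softmax_approx`). So linear combinations of the channels
approximate both the fields `A t` and the integrands `b t · clip_M f_{j t}`, and the means of the
latter give the measurements up to the truncation error `∫ (|f| - M)⁺`. That error is uniformly
small on `S` because `S` is uniformly integrable (`GPO.exists_tail_le`); this is where total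
boundedness enters for `p = 1`.
-/

namespace GPO

/-! ### Exponentials, softmax channels and ReLU networks are dense -/

/-- Finitely many elements of the span of a range are combinations of one common finite family of
generators. -/
lemma exists_fin_family_of_mem_span {ι P M : Type*} [Finite ι] [AddCommGroup M] [Module ℝ M]
    (φ : P → M) (h : ι → M) (hh : ∀ i, h i ∈ Submodule.span ℝ (Set.range φ)) :
    ∃ (N : ℕ) (a : Fin N → P) (c : ι → Fin N → ℝ), ∀ i, h i = ∑ k, c i k • φ (a k) := by
  classical
  cases nonempty_fintype ι
  choose c hc using fun i => Finsupp.mem_span_range_iff_exists_finsupp.1 (hh i)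
  let s : Finset P := Finset.univ.biUnion fun i => (c i).support
  refine ⟨s.card, fun k => (s.equivFin.symm k : P), fun i k => c i (s.equivFin.symm k), fun i => ?_⟩
  rw [Equiv.sum_comp s.equivFin.symm (fun p : s => c i p • φ p), Finset.sum_coe_sort s
    (fun p => c i p • φ p), ← hc i, Finsupp.sum]
  refine Finset.sum_subset (Finset.subset_biUnion_of_mem (fun i => (c i).support)
    (Finset.mem_univ i)) fun p _ hp => ?_
  rw [Finsupp.notMem_support_iff.1 hp, zero_smul]

section Exponentials

variable {X : Type*} [TopologicalSpace X] [CompactSpace X] {κ : Type*} [Fintype κ]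

/-- The function `x ↦ exp ⟨a, u x⟩` on `X`. -/
noncomputable def expFeature (u : X → κ → ℝ) (hu : Continuous u) (a : κ → ℝ) : C(X, ℝ) :=
  ⟨fun x => Real.exp (a ⬝ᵥ u x), Real.continuous_exp.comp (continuous_const.dotProduct hu)⟩

/-- Stone-Weierstrass for exponentials: if `u` separates the points of a compact space, then
finitely many continuous functions are uniformly approximated by combinations of a common family
of exponentials `exp ⟨a, u⟩`. -/
lemma exists_exp_approx {ι : Type*} [Finite ι] (u : X → κ → ℝ) (hu : Continuous u)
    (hinj : Function.Injective u) (h : ι → C(X, ℝ)) {δ : ℝ} (hδ : 0 < δ) :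
    ∃ (N : ℕ) (a : Fin N → κ → ℝ) (c : ι → Fin N → ℝ), ∀ i x,
      |∑ k, c i k * Real.exp (a k ⬝ᵥ u x) - h i x| < δ := by
  classical
  let A : Subalgebra ℝ C(X, ℝ) := Algebra.adjoin ℝ (Set.range (expFeature u hu))
  have hA : A.toSubmodule = Submodule.span ℝ (Set.range (expFeature u hu)) := by
    refine Algebra.adjoin_eq_span_of_subset (R := ℝ) ?_
    refine subset_trans (fun g hg => ?_) Submodule.subset_span
    induction hg using Submonoid.closure_induction with
    | mem g hg => exact hg
    | one => exact ⟨0, by ext x; simp [expFeature]⟩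
    | mul f g _ _ hf hg =>
      obtain ⟨a, rfl⟩ := hf
      obtain ⟨b, rfl⟩ := hg
      exact ⟨a + b, by ext x; simp [expFeature, add_dotProduct, Real.exp_add]⟩
  have hsep : A.SeparatesPoints := by
    intro x y hxy
    obtain ⟨k, hk⟩ : ∃ k, u x k ≠ u y k := by
      by_contra! hcon
      exact hxy (hinj (funext hcon))
    refine ⟨_, ⟨expFeature u hu (Pi.single k 1), Algebra.subset_adjoin ⟨_, rfl⟩, rfl⟩, ?_⟩
    simpa [expFeature] using hk
  have hex : ∀ i, ∃ g : C(X, ℝ), g ∈ A ∧ ‖g - h i‖ < δ := fun i => by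
    obtain ⟨g, hg⟩ := ContinuousMap.exists_mem_subalgebra_near_continuousMap_of_separatesPoints
      A hsep (h i) δ hδ
    exact ⟨g, g.2, hg⟩
  choose g hgA hg using hex
  obtain ⟨N, a, c, hc⟩ := exists_fin_family_of_mem_span (expFeature u hu) g fun i => by
    rw [← hA]; exact hgA i
  refine ⟨N, a, c, fun i x => ?_⟩
  have := ((g i - h i).norm_coe_le_norm x).trans_lt (hg i)
  rw [hc i] at this
  simpa [expFeature, ContinuousMap.sum_apply] using this

lemma abs_div_one_add_sub_le {E s t B C : ℝ} (ht : 0 ≤ t) (hs : 0 ≤ s) (hE : |E| ≤ B)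
    (hsC : s ≤ C) : |E / (1 + t * s) - E| ≤ t * (B * C) := by
  have hden : 0 < 1 + t * s := by positivity
  have : E / (1 + t * s) - E = -(E * (t * s)) / (1 + t * s) := by field_simp; ring
  rw [this, abs_div, abs_neg, abs_mul, abs_of_pos hden, abs_of_nonneg (by positivity : 0 ≤ t * s)]
  refine (div_le_self (by positivity) (by nlinarith [mul_nonneg ht hs])).trans ?_
  calc |E| * (t * s) = t * (|E| * s) := by ring
    _ ≤ t * (B * C) :=
      mul_le_mul_of_nonneg_left (mul_le_mul hE hsC hs ((abs_nonneg _).trans hE)) ht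

/-- Channels of one softmax with affine logits in `u` span a dense space. A reference channel with
logit `0` is added to the exponentials of `exists_exp_approx`, and the other logits are shifted
by a large negative constant, so that the normalizing sum is nearly `1`. -/
lemma exists_softmax_approx {ι : Type*} [Finite ι] (u : X → κ → ℝ) (hu : Continuous u)
    (hinj : Function.Injective u) (h : ι → C(X, ℝ)) {δ : ℝ} (hδ : 0 < δ) :
    ∃ (N : ℕ) (_ : 0 < N) (a : Fin N → κ → ℝ) (b : Fin N → ℝ) (c : ι → Fin N → ℝ), ∀ i x,
      |∑ k, c i k * softmax (fun k => a k ⬝ᵥ u x + b k) k - h i x| < δ := by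
  classical
  cases nonempty_fintype ι
  obtain ⟨N, a, c, hc⟩ := exists_exp_approx u hu hinj h (half_pos hδ)
  -- `S` is the part of the normalizing sum that the shift scales down, `C` bounds the errors
  let S : C(X, ℝ) := ∑ k, expFeature u hu (a k)
  let C : ℝ := ∑ i, ‖∑ k, c i k • expFeature u hu (a k)‖ * ‖S‖
  have hC : 0 ≤ C := Finset.sum_nonneg fun i _ => by positivity
  let t : ℝ := δ / 2 / (C + 1)
  have ht : 0 < t := by positivity
  have htC : t * C < δ / 2 := by
    rw [div_mul_eq_mul_div, div_lt_iff₀ (by positivity)]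
    nlinarith
  refine ⟨N + 1, Nat.succ_pos N, Fin.cons 0 a, Fin.cons 0 fun _ => Real.log t,
    fun i => Fin.cons 0 fun k => c i k / t, fun i x => ?_⟩
  have hSx : S x = ∑ k, Real.exp (a k ⬝ᵥ u x) := by simp [S, expFeature, ContinuousMap.sum_apply]
  have hS0 : 0 ≤ S x := hSx ▸ Finset.sum_nonneg fun k _ => (Real.exp_pos _).le
  have hEx : (∑ k, c i k • expFeature u hu (a k)) x = ∑ k, c i k * Real.exp (a k ⬝ᵥ u x) := by
    simp [expFeature, ContinuousMap.sum_apply]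
  have hden : 0 < 1 + t * S x := by positivity
  have hsum : ∑ k, (Fin.cons 0 fun k => c i k / t : Fin (N + 1) → ℝ) k *
      softmax (fun k => (Fin.cons 0 a : Fin (N + 1) → κ → ℝ) k ⬝ᵥ u x +
        (Fin.cons 0 fun _ => Real.log t : Fin (N + 1) → ℝ) k) k
      = (∑ k, c i k * Real.exp (a k ⬝ᵥ u x)) / (1 + t * S x) := by
    simp only [softmax, Fin.sum_univ_succ, Fin.cons_zero, Fin.cons_succ, zero_dotProduct,
      Real.exp_add, Real.exp_log ht, Real.exp_zero, zero_mul, zero_add, hSx,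
      Finset.sum_div, Finset.mul_sum]
    refine Finset.sum_congr rfl fun k _ => ?_
    simp only [mul_comm t]
    field_simp
  rw [hsum, ← hEx]
  have h1 : |(∑ k, c i k • expFeature u hu (a k)) x / (1 + t * S x) -
      (∑ k, c i k • expFeature u hu (a k)) x| ≤ t * C := by
    refine (abs_div_one_add_sub_le ht.le hS0 (ContinuousMap.norm_coe_le_norm
      (∑ k, c i k • expFeature u hu (a k)) x) ((le_abs_self _).trans
      (ContinuousMap.norm_coe_le_norm S x))).trans (mul_le_mul_of_nonneg_left ?_ ht.le)
    exact Finset.single_le_sum (f := fun i => ‖∑ k, c i k • expFeature u hu (a k)‖ * ‖S‖)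
      (fun i _ => mul_nonneg (norm_nonneg _) (norm_nonneg _)) (Finset.mem_univ i)
  have h2 := hc i x
  rw [← hEx] at h2
  generalize (∑ k, c i k • expFeature u hu (a k)) x = E at h1 h2 ⊢
  calc |E / (1 + t * S x) - h i x| = |(E / (1 + t * S x) - E) + (E - h i x)| := by ring_nf
    _ ≤ |E / (1 + t * S x) - E| + |E - h i x| := abs_add_le _ _
    _ < δ := by linarith

end Exponentials

section ReLU

/-- On `(-∞, 1]` the square of the positive part is a Riemann sum of shifted ReLUs up to `1 / n`:
with `a i = max (t - i / n) 0`, the squares `a i ^ 2` telescope and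
`a i ^ 2 - a (i + 1) ^ 2` differs from `2 a i / n` by at most `1 / n ^ 2`. -/
lemma abs_sq_sub_sum_relu_le {t : ℝ} (ht : t ≤ 1) {n : ℕ} (hn : 0 < n) :
    |(max t 0) ^ 2 - 2 / (n : ℝ) * ∑ i : Fin n, max (t - ((i : ℕ) : ℝ) / n) 0| ≤ (1 : ℝ) / n := by
  have hn' : (0 : ℝ) < n := by exact_mod_cast hn
  rw [Fin.sum_univ_eq_sum_range (fun i => max (t - (i : ℝ) / n) 0) n]
  have htel : (max t 0) ^ 2 = ∑ i ∈ Finset.range n,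
      ((max (t - (i : ℝ) / n) 0) ^ 2 - (max (t - ((i + 1 : ℕ) : ℝ) / n) 0) ^ 2) := by
    rw [Finset.sum_range_sub' (fun i : ℕ => ((max (t - (i : ℝ) / n) 0) ^ 2 : ℝ)),
      div_self hn'.ne', max_eq_right (a := t - 1) (by linarith)]
    simp
  rw [htel, Finset.mul_sum, ← Finset.sum_sub_distrib]
  refine (Finset.abs_sum_le_sum_abs _ _).trans ?_
  have hterm : ∀ i ∈ Finset.range n, |(max (t - (i : ℝ) / n) 0) ^ 2 -
      (max (t - ((i + 1 : ℕ) : ℝ) / n) 0) ^ 2 - 2 / n * max (t - (i : ℝ) / n) 0| ≤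
      1 / ((n : ℝ) * n) := by
    intro i _
    have h1 : t - ((i + 1 : ℕ) : ℝ) / n = (t - (i : ℝ) / n) - 1 / n := by push_cast; ring
    rw [h1, show (2 : ℝ) / n = 2 * (1 / n) by ring,
      show (1 : ℝ) / (n * n) = (1 / n) * (1 / n) by ring]
    have he : (0 : ℝ) < 1 / n := by positivity
    generalize (1 : ℝ) / n = e at he ⊢
    generalize t - (i : ℝ) / n = s
    rw [abs_le]
    rcases le_total s 0 with hs | hs
    · rw [max_eq_right hs, max_eq_right (by linarith)]
      constructor <;> nlinarith
    · rw [max_eq_left hs]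
      rcases le_total (s - e) 0 with hs' | hs'
      · rw [max_eq_right hs']
        constructor <;> nlinarith
      · rw [max_eq_left hs']
        constructor <;> nlinarith
  refine (Finset.sum_le_sum hterm).trans (le_of_eq ?_)
  rw [Finset.sum_const, Finset.card_range, nsmul_eq_mul]
  field_simp

variable {γ : Type*} [Fintype γ]

/-- The hidden unit `y ↦ ReLU (⟨a, y⟩ + b)` as a continuous function on a set `Y`. -/
noncomputable def reluUnit (Y : Set (γ → ℝ)) (ab : (γ → ℝ) × ℝ) : C(Y, ℝ) :=
  ⟨fun y => max (ab.1 ⬝ᵥ (y : γ → ℝ) + ab.2) 0,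
    ((continuous_const.dotProduct continuous_subtype_val).add continuous_const).max
      continuous_const⟩

/-- The linear form `⟨a, ·⟩` as a continuous function on a set `Y`. -/
noncomputable def linForm (Y : Set (γ → ℝ)) (a : γ → ℝ) : C(Y, ℝ) :=
  ⟨fun y => a ⬝ᵥ (y : γ → ℝ), continuous_const.dotProduct continuous_subtype_val⟩

lemma linForm_sq_mem_closure {Y : Set (γ → ℝ)} [CompactSpace Y] (a : γ → ℝ) :
    (linForm Y a) ^ 2 ∈
      (Submodule.span ℝ (Set.range (reluUnit Y))).topologicalClosure := by
  rw [← SetLike.mem_coe, Submodule.topologicalClosure_coe, Metric.mem_closure_iff]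
  intro δ hδ
  set R : ℝ := ‖linForm Y a‖ + 1 with hR
  have hR0 : 0 < R := by positivity
  obtain ⟨n, hn⟩ := exists_nat_gt (R ^ 2 * 2 / δ)
  have hn0 : (0 : ℝ) < n := lt_of_le_of_lt (by positivity) hn
  have hn0' : 0 < n := by exact_mod_cast hn0
  refine ⟨∑ i : Fin n, (R ^ 2 * (2 / n)) • (reluUnit Y (R⁻¹ • a, -(((i : ℕ) : ℝ) / n)) +
    reluUnit Y (-(R⁻¹ • a), -(((i : ℕ) : ℝ) / n))), ?_, ?_⟩
  · refine Submodule.sum_mem _ fun i _ => Submodule.smul_mem _ _ (Submodule.add_mem _ ?_ ?_) <;>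
    exact Submodule.subset_span ⟨_, rfl⟩
  · rw [ContinuousMap.dist_lt_iff hδ]
    intro y
    have hs : |R⁻¹ * (a ⬝ᵥ (y : γ → ℝ))| ≤ 1 := by
      rw [abs_mul, abs_of_pos (inv_pos.2 hR0), inv_mul_le_iff₀ hR0, mul_one]
      have : |a ⬝ᵥ (y : γ → ℝ)| ≤ ‖linForm Y a‖ := ContinuousMap.norm_coe_le_norm (linForm Y a) y
      linarith
    have e1 := abs_sq_sub_sum_relu_le (abs_le.1 hs).2 hn0'
    have e2 := abs_sq_sub_sum_relu_le (t := -(R⁻¹ * (a ⬝ᵥ (y : γ → ℝ))))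
      (by linarith [(abs_le.1 hs).1]) hn0'
    have hval : (∑ i : Fin n, (R ^ 2 * (2 / n)) • (reluUnit Y (R⁻¹ • a, -(((i : ℕ) : ℝ) / n)) +
        reluUnit Y (-(R⁻¹ • a), -(((i : ℕ) : ℝ) / n)))) y = R ^ 2 * (2 / n *
        ∑ i : Fin n, max (R⁻¹ * (a ⬝ᵥ (y : γ → ℝ)) - ((i : ℕ) : ℝ) / n) 0 + 2 / n *
        ∑ i : Fin n, max (-(R⁻¹ * (a ⬝ᵥ (y : γ → ℝ))) - ((i : ℕ) : ℝ) / n) 0) := by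
      simp only [ContinuousMap.sum_apply, ContinuousMap.smul_apply, ContinuousMap.add_apply,
        reluUnit, ContinuousMap.coe_mk, smul_dotProduct, neg_dotProduct, smul_eq_mul,
        Finset.mul_sum, mul_add, Finset.sum_add_distrib, ← sub_eq_add_neg, mul_assoc]
    have hsq : (linForm Y a ^ 2) y = R ^ 2 * ((max (R⁻¹ * (a ⬝ᵥ (y : γ → ℝ))) 0) ^ 2 +
        (max (-(R⁻¹ * (a ⬝ᵥ (y : γ → ℝ)))) 0) ^ 2) := by
      have hlin : (linForm Y a ^ 2) y = R ^ 2 * (R⁻¹ * (a ⬝ᵥ (y : γ → ℝ))) ^ 2 := by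
        simp only [ContinuousMap.pow_apply, linForm, ContinuousMap.coe_mk]
        field_simp
      rw [hlin]
      generalize R⁻¹ * (a ⬝ᵥ (y : γ → ℝ)) = s
      rcases le_total s 0 with h | h
      · rw [max_eq_right h, max_eq_left (by linarith)]; ring
      · rw [max_eq_left h, max_eq_right (by linarith)]; ring
    rw [hval, hsq, Real.dist_eq, ← mul_sub, abs_mul, abs_of_pos (by positivity : 0 < R ^ 2)]
    have e3 := (abs_add_le _ _).trans (add_le_add e1 e2)
    rw [div_lt_iff₀ hδ] at hn
    calc _ ≤ R ^ 2 * (1 / n + 1 / n) := by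
          refine mul_le_mul_of_nonneg_left (le_trans (le_of_eq ?_) e3) (by positivity)
          congr 1; ring
      _ < δ := by
          rw [← add_div, ← mul_div_assoc, div_lt_iff₀ hn0]
          linarith

/-- One hidden ReLU layer approximates finitely many sums of products of linear forms, uniformly
on bounded sets. Products reduce to squares by polarization. -/
lemma exists_relu_approx_bilinear {ι τ : Type*} [Finite ι] [Fintype τ] (p : τ → ι → γ → ℝ)
    (q : τ → γ → ℝ) (R : ℝ) {δ : ℝ} (hδ : 0 < δ) :
    ∃ (n : ℕ) (a : Fin n → γ → ℝ) (b : Fin n → ℝ) (c : ι → Fin n → ℝ), ∀ y : γ → ℝ,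
      (∀ g, |y g| ≤ R) → ∀ i,
      |∑ k, c i k * max (a k ⬝ᵥ y + b k) 0 - ∑ t, (p t i ⬝ᵥ y) * (q t ⬝ᵥ y)| < δ := by
  let Y : Set (γ → ℝ) := Set.Icc (fun _ => -R) (fun _ => R)
  have : CompactSpace Y := isCompact_iff_compactSpace.1 isCompact_Icc
  have hprod : ∀ a b : γ → ℝ, linForm Y a * linForm Y b ∈
      (Submodule.span ℝ (Set.range (reluUnit Y))).topologicalClosure := by
    intro a b
    have : linForm Y a * linForm Y b =
        (1 / 4 : ℝ) • (linForm Y (a + b) ^ 2 - linForm Y (a - b) ^ 2) := by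
      ext y
      simp only [linForm, ContinuousMap.mul_apply, ContinuousMap.coe_mk, ContinuousMap.smul_apply,
        ContinuousMap.sub_apply, ContinuousMap.pow_apply, add_dotProduct, sub_dotProduct,
        smul_eq_mul]
      ring
    rw [this]
    exact Submodule.smul_mem _ _ (Submodule.sub_mem _ (linForm_sq_mem_closure _)
      (linForm_sq_mem_closure _))
  have hmem : ∀ i, ∑ t, linForm Y (p t i) * linForm Y (q t) ∈
      (Submodule.span ℝ (Set.range (reluUnit Y))).topologicalClosure := fun i =>
    Submodule.sum_mem _ fun t _ => hprod _ _
  have hex : ∀ i, ∃ g ∈ Submodule.span ℝ (Set.range (reluUnit Y)),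
      dist (∑ t, linForm Y (p t i) * linForm Y (q t)) g < δ := fun i => by
    have := hmem i
    rw [← SetLike.mem_coe, Submodule.topologicalClosure_coe, Metric.mem_closure_iff] at this
    exact this δ hδ
  choose g hg hgd using hex
  obtain ⟨n, ab, c, hc⟩ := exists_fin_family_of_mem_span (reluUnit Y) g hg
  refine ⟨n, fun k => (ab k).1, fun k => (ab k).2, c, fun y hy i => ?_⟩
  have hyY : y ∈ Y := ⟨fun g => (abs_le.1 (hy g)).1, fun g => (abs_le.1 (hy g)).2⟩
  have := (ContinuousMap.dist_lt_iff hδ).1 (hgd i) ⟨y, hyY⟩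
  rw [dist_comm, Real.dist_eq, hc i] at this
  simpa [reluUnit, linForm, ContinuousMap.sum_apply] using this

end ReLU

/-! ### Uniform integrability -/

section Tails

open scoped NNReal

variable {α F : Type*} {m : MeasurableSpace α} {μ : Measure α} [NormedAddCommGroup F]

/-- On a finite measure space the `L^r` norms of a bounded subset of `L^p`, `r ≤ p`, are
bounded. -/
lemma exists_eLpNorm_le [IsFiniteMeasure μ] {r p : ℝ≥0∞} (hr : 1 ≤ r) (hrp : r ≤ p) :
    ∃ C : ℝ≥0, ∀ f : α → F, AEStronglyMeasurable f μ → eLpNorm f r μ ≤ eLpNorm f p μ * C := by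
  have hr0 : r ≠ 0 := (zero_lt_one.trans_le hr).ne'
  have hexp : 0 ≤ 1 / r.toReal - 1 / p.toReal := by
    rw [sub_nonneg]
    rcases eq_or_ne p ∞ with rfl | hp
    · simp
    · exact one_div_le_one_div_of_le (ENNReal.toReal_pos hr0 (ne_top_of_le_ne_top hp hrp))
        (ENNReal.toReal_mono hp hrp)
  have hfin : μ Set.univ ^ (1 / r.toReal - 1 / p.toReal) ≠ ∞ :=
    ENNReal.rpow_ne_top_of_nonneg hexp (measure_ne_top μ _)
  refine ⟨(μ Set.univ ^ (1 / r.toReal - 1 / p.toReal)).toNNReal, fun f hf => ?_⟩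
  rw [ENNReal.coe_toNNReal hfin]
  exact eLpNorm_le_eLpNorm_mul_rpow_measure_univ hrp hf

/-- On a finite measure space the `L^q` norm is bounded by a multiple of an almost everywhere
bound. -/
lemma exists_eLpNorm_le_of_ae_bound [IsFiniteMeasure μ] (q : ℝ≥0∞) :
    ∃ C : ℝ, 0 ≤ C ∧ ∀ (f : α → F) (c : ℝ), (∀ᵐ x ∂μ, ‖f x‖ ≤ c) →
      eLpNorm f q μ ≤ ENNReal.ofReal (C * c) := by
  have hfin : μ Set.univ ^ q.toReal⁻¹ ≠ ∞ :=
    ENNReal.rpow_ne_top_of_nonneg (by positivity) (measure_ne_top μ _)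
  refine ⟨(μ Set.univ ^ q.toReal⁻¹).toReal, ENNReal.toReal_nonneg, fun f c hc => ?_⟩
  rw [ENNReal.ofReal_mul ENNReal.toReal_nonneg, ENNReal.ofReal_toReal hfin]
  exact eLpNorm_le_of_ae_bound hc

lemma exists_eLpNorm_le_of_isBounded {p : ℝ≥0∞} [Fact (1 ≤ p)] {S : Set (Lp F p μ)}
    (hS : Bornology.IsBounded S) : ∃ R : ℝ≥0, ∀ f ∈ S, eLpNorm f p μ ≤ R := by
  obtain ⟨R, hR⟩ := hS.exists_norm_le
  refine ⟨R.toNNReal, fun f hf => ?_⟩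
  rw [← Lp.enorm_def, ← ofReal_norm]
  exact ENNReal.ofReal_le_ofReal (hR f hf)

lemma exists_integral_norm_le [IsFiniteMeasure μ] {p : ℝ≥0∞} (hp : 1 ≤ p) (R : ℝ≥0) :
    ∃ C : ℝ, 0 ≤ C ∧ ∀ f : α → F, MemLp f p μ → eLpNorm f p μ ≤ R → ∫ x, ‖f x‖ ∂μ ≤ C := by
  obtain ⟨C, hC⟩ := exists_eLpNorm_le (μ := μ) (F := F) le_rfl hp
  refine ⟨R * C, by positivity, fun f hf hfR => ?_⟩
  rw [integral_norm_eq_lintegral_enorm hf.1, ← eLpNorm_one_eq_lintegral_enorm]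
  refine ENNReal.toReal_le_of_le_ofReal (by positivity) ?_
  rw [ENNReal.ofReal_mul R.coe_nonneg, ENNReal.ofReal_coe_nnreal, ENNReal.ofReal_coe_nnreal]
  exact (hC f hf.1).trans (mul_le_mul_left hfR _)

lemma ofReal_norm_sub_le {s M : ℝ} (hs : 1 < s) (hM : 0 < M) (v : F) :
    ENNReal.ofReal (‖v‖ - M) ≤ ENNReal.ofReal (M ^ (-(s - 1))) * ‖v‖ₑ ^ s := by
  rcases le_total ‖v‖ M with h | h
  · rw [ENNReal.ofReal_of_nonpos (by linarith)]
    exact zero_le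
  · have hv : 0 < ‖v‖ := hM.trans_le h
    rw [← ofReal_norm, ENNReal.ofReal_rpow_of_nonneg (norm_nonneg _) (by linarith),
      ← ENNReal.ofReal_mul (by positivity)]
    refine ENNReal.ofReal_le_ofReal ?_
    have h1 : 1 ≤ M ^ (-(s - 1)) * ‖v‖ ^ (s - 1) := by
      rw [Real.rpow_neg hM.le, ← div_eq_inv_mul, one_le_div (by positivity)]
      exact Real.rpow_le_rpow hM.le h (by linarith)
    have h2 : ‖v‖ ^ s = ‖v‖ ^ (s - 1) * ‖v‖ := by
      conv_rhs => rw [← Real.rpow_add_one hv.ne']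
      simp
    rw [h2, ← mul_assoc]
    nlinarith

/-- Bounded subsets of `L^p`, `p > 1`, and totally bounded subsets of `L^1` are uniformly
integrable: truncation at a large level costs little in `L^1`. -/
lemma exists_tail_le [IsFiniteMeasure μ] {p : ℝ≥0∞} [hp1 : Fact (1 ≤ p)] {S : Set (Lp F p μ)}
    (hS : Bornology.IsBounded S) (hp : 1 < p ∨ TotallyBounded S) {δ : ℝ} (hδ : 0 < δ) :
    ∃ M : ℝ, 0 < M ∧ ∀ f ∈ S, ∫⁻ x, ENNReal.ofReal (‖f x‖ - M) ∂μ ≤ ENNReal.ofReal δ := by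
  rcases hp with hp | hp
  · -- the exponent `s = min p 2` is finite, and `(t - M)⁺ ≤ M ^ (1 - s) t ^ s`
    obtain ⟨R, hR⟩ := exists_eLpNorm_le_of_isBounded hS
    obtain ⟨s, hs⟩ : ∃ s : ℝ≥0, (s : ℝ≥0∞) = min p 2 :=
      ⟨(min p 2).toNNReal, ENNReal.coe_toNNReal (by simp)⟩
    have hs1 : 1 < s := by
      rw [← ENNReal.coe_lt_coe, hs, ENNReal.coe_one]
      exact lt_min hp (by norm_num)
    obtain ⟨C, hC⟩ := exists_eLpNorm_le (μ := μ) (F := F) (r := s) (p := p)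
      (by exact_mod_cast hs1.le) (by rw [hs]; exact min_le_left _ _)
    have hlim : Filter.Tendsto (fun M : ℝ => M ^ (-((s : ℝ) - 1)) * ((R * C : ℝ≥0) : ℝ) ^ (s : ℝ))
        Filter.atTop (nhds (0 * _)) :=
      (tendsto_rpow_neg_atTop (by
        have : (1 : ℝ) < s := by exact_mod_cast hs1
        linarith)).mul_const _
    rw [zero_mul] at hlim
    obtain ⟨M, hM, hM0⟩ := ((hlim.eventually_le_const hδ).and (Filter.eventually_gt_atTop 0)).exists
    refine ⟨M, hM0, fun f hf => ?_⟩
    calc ∫⁻ x, ENNReal.ofReal (‖f x‖ - M) ∂μ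
        ≤ ∫⁻ x, ENNReal.ofReal (M ^ (-((s : ℝ) - 1))) * ‖f x‖ₑ ^ (s : ℝ) ∂μ :=
          lintegral_mono fun x => ofReal_norm_sub_le (by exact_mod_cast hs1) hM0 _
      _ = ENNReal.ofReal (M ^ (-((s : ℝ) - 1))) * eLpNorm f s μ ^ (s : ℝ) := by
          rw [lintegral_const_mul' _ _ ENNReal.ofReal_ne_top,
            eLpNorm_nnreal_pow_eq_lintegral (zero_lt_one.trans hs1).ne']
      _ ≤ ENNReal.ofReal (M ^ (-((s : ℝ) - 1))) * ((R * C : ℝ≥0) : ℝ≥0∞) ^ (s : ℝ) := by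
          gcongr
          rw [ENNReal.coe_mul]
          exact (hC f (Lp.aestronglyMeasurable f)).trans (mul_le_mul_left (hR f hf) _)
      _ ≤ ENNReal.ofReal δ := by
          rw [← ENNReal.ofReal_coe_nnreal,
            ENNReal.ofReal_rpow_of_nonneg (R * C).coe_nonneg s.coe_nonneg,
            ← ENNReal.ofReal_mul (by positivity)]
          exact ENNReal.ofReal_le_ofReal hM
  · -- the truncation error is `1`-Lipschitz in `L^1`, so a finite net suffices
    obtain ⟨C, hC⟩ := exists_eLpNorm_le (μ := μ) (F := F) le_rfl hp1.out
    obtain ⟨t, ht, hSt⟩ := Metric.totallyBounded_iff.1 hp (δ / 2 / (C + 1)) (by positivity)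
    have hsingle : ∀ g : Lp F p μ, ∃ M : ℕ, ∀ n : ℕ, M ≤ n →
        ∫⁻ x, ENNReal.ofReal (‖g x‖ - n) ∂μ ≤ ENNReal.ofReal (δ / 2) := by
      intro g
      have hlim : Filter.Tendsto (fun n : ℕ => ∫⁻ x, ENNReal.ofReal (‖g x‖ - n) ∂μ) Filter.atTop
          (nhds (∫⁻ _, 0 ∂μ)) := by
        refine tendsto_lintegral_of_dominated_convergence' (fun x => ‖g x‖ₑ) (fun n => ?_)
          (fun n => .of_forall fun x => ?_) ?_ (.of_forall fun x => ?_)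
        · exact ((Lp.aestronglyMeasurable g).norm.aemeasurable.sub_const _).ennreal_ofReal
        · beta_reduce
          rw [← ofReal_norm]
          exact ENNReal.ofReal_le_ofReal (by simp)
        · rw [← eLpNorm_one_eq_lintegral_enorm]
          exact ((Lp.memLp g).mono_exponent hp1.out).2.ne
        · refine tendsto_const_nhds.congr' ?_
          filter_upwards [(tendsto_natCast_atTop_atTop (R := ℝ)).eventually_ge_atTop ‖g x‖]
            with n hn
          rw [ENNReal.ofReal_of_nonpos (by linarith)]
      rw [lintegral_zero] at hlim
      exact Filter.eventually_atTop.1 (hlim.eventually_le_const (by simpa using hδ))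
    choose M hM using hsingle
    obtain ⟨n, hn⟩ := (ht.image M).bddAbove
    refine ⟨(n + 1 : ℕ), by positivity, fun f hf => ?_⟩
    obtain ⟨g, hg, hfg⟩ := Set.mem_iUnion₂.1 (hSt hf)
    have hgn : M g ≤ n + 1 := (hn ⟨g, hg, rfl⟩).trans n.le_succ
    have h1 : ∫⁻ x, ‖(f - g : Lp F p μ) x‖ₑ ∂μ ≤ ENNReal.ofReal (δ / 2) := by
      rw [← eLpNorm_one_eq_lintegral_enorm]
      refine (hC _ (Lp.aestronglyMeasurable _)).trans ?_
      rw [← Lp.enorm_def, ← ofReal_norm, ← ENNReal.ofReal_coe_nnreal,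
        ← ENNReal.ofReal_mul (norm_nonneg _), ← dist_eq_norm]
      refine ENNReal.ofReal_le_ofReal ?_
      have := (Metric.mem_ball.1 hfg).le
      rw [le_div_iff₀ (by positivity)] at this
      nlinarith [dist_nonneg (x := f) (y := g)]
    calc ∫⁻ x, ENNReal.ofReal (‖f x‖ - (n + 1 : ℕ)) ∂μ
        ≤ ∫⁻ x, ‖(f - g : Lp F p μ) x‖ₑ + ENNReal.ofReal (‖g x‖ - (n + 1 : ℕ)) ∂μ := by
          refine lintegral_mono_ae ?_
          filter_upwards [Lp.coeFn_sub f g] with x hx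
          rw [hx, Pi.sub_apply, ← ofReal_norm]
          refine le_trans (ENNReal.ofReal_le_ofReal ?_) ENNReal.ofReal_add_le
          linarith [norm_sub_norm_le (f x) (g x)]
      _ ≤ ENNReal.ofReal (δ / 2) + ENNReal.ofReal (δ / 2) := by
          rw [lintegral_add_left' (Lp.aestronglyMeasurable _).enorm]
          exact add_le_add h1 (hM g _ hgn)
      _ = ENNReal.ofReal δ := by
          rw [← ENNReal.ofReal_add (by positivity) (by positivity), add_halves]

end Tails

/-! ### Reduction to separable operators -/

section Separable

open scoped NNReal

variable {d cin cout : ℕ}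

lemma sum_smul_single {n : ℕ} (v : E n) : ∑ j, v j • EuclideanSpace.single j (1 : ℝ) = v := by
  simpa using (EuclideanSpace.basisFun (Fin n) ℝ).sum_repr v

lemma norm_le_sum_abs {n : ℕ} (v : E n) : ‖v‖ ≤ ∑ j, |v j| := by
  conv_lhs => rw [← sum_smul_single v]
  refine (norm_sum_le _ _).trans (le_of_eq ?_)
  simp [norm_smul]

lemma abs_apply_le_norm {n : ℕ} (v : E n) (j : Fin n) : |v j| ≤ ‖v‖ := PiLp.norm_apply_le v j

lemma integral_apply {α : Type*} {m : MeasurableSpace α} {μ : Measure α} {n : ℕ} {g : α → E n}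
    (hg : Integrable g μ) (j : Fin n) : (∫ x, g x ∂μ) j = ∫ x, g x j ∂μ :=
  ((EuclideanSpace.proj (𝕜 := ℝ) j).integral_comp_comm hg).symm

/-- The separable operator `f ↦ ∑ t, (∫_Ω b t · f_{j t}) A t`, a finite sum of scalar measurements
of the components of `f`, each multiplied by a fixed output field. -/
noncomputable def sepOp {ι : Type*} [Fintype ι] (Ω : Set (E d)) (A : ι → E d → E cout)
    (b : ι → E d → ℝ) (j : ι → Fin cin) (f : E d → E cin) (x : E d) : E cout :=
  ∑ t, (∫ y in Ω, b t y * f y (j t)) • A t x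

variable {Ω : Set (E d)}

lemma isFiniteMeasure_restrict (hΩ : IsCompact Ω) : IsFiniteMeasure (volume.restrict Ω) :=
  ⟨by simpa using hΩ.measure_lt_top⟩

lemma aestronglyMeasurable_sepOp {ι : Type*} [Fintype ι] (hΩ : IsCompact Ω)
    {A : ι → E d → E cout} (hA : ∀ t, ContinuousOn (A t) Ω) (b : ι → E d → ℝ) (j : ι → Fin cin)
    (f : E d → E cin) : AEStronglyMeasurable (sepOp Ω A b j f) (volume.restrict Ω) := by
  refine ContinuousOn.aestronglyMeasurable ?_ hΩ.measurableSet
  unfold sepOp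
  exact continuousOn_finsetSum _ fun t _ => by
    have := hA t
    fun_prop

lemma integrable_apply {f : E d → E cin} (hf : Integrable f (volume.restrict Ω)) (j : Fin cin) :
    Integrable (fun x => f x j) (volume.restrict Ω) :=
  (EuclideanSpace.proj (𝕜 := ℝ) j).integrable_comp hf

lemma lowRank_eq_sepOp (hΩ : IsCompact Ω) {m : ℕ} {Φ : E d → E m} (hΦ : ContinuousOn Φ Ω)
    (𝒦 : Fin m → Fin m → E cin →L[ℝ] E cout) {f : E d → E cin}
    (hf : Integrable f (volume.restrict Ω)) (x : E d) :
    lowRank Ω Φ 𝒦 f x = sepOp Ω (fun (t : Fin m × Fin cin) x =>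
      ∑ k, Φ x k • 𝒦 k t.1 (EuclideanSpace.single t.2 1)) (fun t y => Φ y t.1)
      (fun t => t.2) f x := by
  have hΦl : ∀ l, ContinuousOn (fun y => Φ y l) Ω := fun l =>
    (EuclideanSpace.proj (𝕜 := ℝ) l).continuous.comp_continuousOn hΦ
  have hint : ∀ l, Integrable (fun y => Φ y l • f y) (volume.restrict Ω) := fun l =>
    IntegrableOn.continuousOn_smul hf (hΦl l) hΩ
  have hexp : ∀ k l, 𝒦 k l (∫ y in Ω, Φ y l • f y) =
      ∑ i, (∫ y in Ω, Φ y l * f y i) • 𝒦 k l (EuclideanSpace.single i 1) := by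
    intro k l
    conv_lhs => rw [← sum_smul_single (∫ y in Ω, Φ y l • f y), map_sum]
    simp only [map_smul, integral_apply (hint l)]
    simp
  simp only [lowRank, sepOp, hexp, Fintype.sum_prod_type, Finset.smul_sum]
  rw [Finset.sum_comm]
  refine Finset.sum_congr rfl fun l _ => ?_
  rw [Finset.sum_comm]
  refine Finset.sum_congr rfl fun i _ => Finset.sum_congr rfl fun k _ => ?_
  rw [smul_comm]

/-- A kernel that is continuous on `Ω × Ω` is uniformly close to a combination of products
`exp ⟨a₁, x⟩ exp ⟨a₂, y⟩`, so its integral operator is close to a separable one on bounded sets. -/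
lemma exists_sepOp_of_continuousOn (hΩ : IsCompact Ω) {K : E d → E d → E cin →L[ℝ] E cout}
    (hK : ContinuousOn (Function.uncurry K) (Ω ×ˢ Ω)) {p : ℝ≥0∞} (hp : 1 ≤ p) (q : ℝ≥0∞) (R : ℝ≥0)
    {η : ℝ} (hη : 0 < η) :
    ∃ (ι : Type) (_ : Fintype ι) (A : ι → E d → E cout) (b : ι → E d → ℝ) (j : ι → Fin cin),
      (∀ t, ContinuousOn (A t) Ω) ∧ (∀ t, ContinuousOn (b t) Ω) ∧
      ∀ f : E d → E cin, MemLp f p (volume.restrict Ω) → eLpNorm f p (volume.restrict Ω) ≤ R →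
        eLpNorm (fun x => (∫ y in Ω, K x y (f y)) - sepOp Ω A b j f x) q (volume.restrict Ω)
          ≤ ENNReal.ofReal η := by
  have := isFiniteMeasure_restrict hΩ
  obtain ⟨C, hC0, hC⟩ := exists_eLpNorm_le_of_ae_bound (μ := volume.restrict Ω) (F := E cout) q
  obtain ⟨L, hL0, hL⟩ := exists_integral_norm_le (μ := volume.restrict Ω) (F := E cin) hp R
  have hXc : CompactSpace (Ω ×ˢ Ω : Set (E d × E d)) :=
    isCompact_iff_compactSpace.1 (hΩ.prod hΩ)
  let u : (Ω ×ˢ Ω : Set (E d × E d)) → Fin d ⊕ Fin d → ℝ := fun z =>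
    Sum.elim (fun l => z.1.1 l) (fun l => z.1.2 l)
  have hu : Continuous u := by
    refine continuous_pi fun l => ?_
    rcases l with l | l
    · exact (EuclideanSpace.proj (𝕜 := ℝ) l).continuous.comp
        (continuous_fst.comp continuous_subtype_val)
    · exact (EuclideanSpace.proj (𝕜 := ℝ) l).continuous.comp
        (continuous_snd.comp continuous_subtype_val)
  have hinj : Function.Injective u := by
    intro z z' h
    refine Subtype.ext (Prod.ext (PiLp.ext fun l => ?_) (PiLp.ext fun l => ?_))
    · exact congrFun h (Sum.inl l)
    · exact congrFun h (Sum.inr l)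
  let h : Fin cout × Fin cin → C((Ω ×ˢ Ω : Set (E d × E d)), ℝ) := fun ij =>
    ⟨fun z => K z.1.1 z.1.2 (EuclideanSpace.single ij.2 1) ij.1, by
      have h1 : Continuous fun z : (Ω ×ˢ Ω : Set (E d × E d)) => K z.1.1 z.1.2 :=
        continuousOn_iff_continuous_domRestrict.1 hK
      exact (EuclideanSpace.proj (𝕜 := ℝ) ij.1).continuous.comp
        (h1.clm_apply continuous_const)⟩
  let B : ℝ := C * (cout * (cin * L)) + 1
  have hB : 0 < B := by positivity
  obtain ⟨N, a, c, hc⟩ := exists_exp_approx u hu hinj h (div_pos hη hB)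
  refine ⟨Fin N × Fin cin, inferInstance,
    fun t x => WithLp.toLp 2 fun i =>
      c (i, t.2) t.1 * Real.exp ((fun l => a t.1 (.inl l)) ⬝ᵥ x.ofLp),
    fun t y => Real.exp ((fun l => a t.1 (.inr l)) ⬝ᵥ y.ofLp), fun t => t.2,
    fun t => ?_, fun t => ?_, fun f hf hfR => ?_⟩
  · refine Continuous.continuousOn ((PiLp.continuous_toLp 2 _).comp (continuous_pi fun i => ?_))
    exact continuous_const.mul (Real.continuous_exp.comp
      (continuous_const.dotProduct (PiLp.continuous_ofLp 2 _)))
  · exact (Real.continuous_exp.comp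
      (continuous_const.dotProduct (PiLp.continuous_ofLp 2 _))).continuousOn
  have hfi : Integrable f (volume.restrict Ω) := memLp_one_iff_integrable.1 (hf.mono_exponent hp)
  have hbound : ∀ᵐ x ∂volume.restrict Ω, ‖(∫ y in Ω, K x y (f y)) - sepOp Ω
      (fun (t : Fin N × Fin cin) x => (WithLp.toLp 2 fun i =>
        c (i, t.2) t.1 * Real.exp ((fun l => a t.1 (.inl l)) ⬝ᵥ x.ofLp) : E cout))
      (fun t y => Real.exp ((fun l => a t.1 (.inr l)) ⬝ᵥ y.ofLp)) (fun t => t.2) f x‖ ≤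
      cout * (cin * (η / B)) * L := by
    refine ae_restrict_of_forall_mem hΩ.measurableSet fun x hx => ?_
    have hKx : ContinuousOn (K x) Ω :=
      hK.comp (continuousOn_const.prodMk continuousOn_id) fun y hy => ⟨hx, hy⟩
    have hKi : Integrable (fun y => K x y (f y)) (volume.restrict Ω) := by
      obtain ⟨C', hC'⟩ := hΩ.exists_bound_of_continuousOn hKx
      exact (ContinuousLinearMap.id ℝ (E cin →L[ℝ] E cout)).integrable_of_bilin_of_bdd_left C'
        (hKx.aestronglyMeasurable hΩ.measurableSet)
        (ae_restrict_of_forall_mem hΩ.measurableSet hC') hfi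
    have hbi : ∀ t : Fin N × Fin cin, Integrable (fun y : E d =>
        Real.exp ((fun l => a t.1 (.inr l)) ⬝ᵥ y.ofLp) * f y t.2) (volume.restrict Ω) := fun t =>
      IntegrableOn.continuousOn_mul (Real.continuous_exp.comp
        (continuous_const.dotProduct (PiLp.continuous_ofLp 2 _))).continuousOn
        (integrable_apply hfi t.2) hΩ
    rw [sepOp]
    simp only [← integral_smul_const]
    rw [← integral_finsetSum _ fun t _ => (hbi t).smul_const _,
      ← integral_sub hKi (integrable_finsetSum _ fun t _ => (hbi t).smul_const _)]
    refine (norm_integral_le_integral_norm _).trans ?_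
    refine le_trans ?_ (mul_le_mul_of_nonneg_left (hL f hf hfR) (by positivity))
    rw [← integral_const_mul]
    refine integral_mono_of_nonneg (.of_forall fun y => norm_nonneg _)
      (hfi.norm.const_mul _) (ae_restrict_of_forall_mem hΩ.measurableSet fun y hy => ?_)
    refine (norm_le_sum_abs _).trans ?_
    have hcoord : ∀ i, |(K x y (f y) - ∑ t : Fin N × Fin cin,
        (Real.exp ((fun l => a t.1 (.inr l)) ⬝ᵥ y.ofLp) * f y t.2) • (WithLp.toLp 2 fun i =>
          c (i, t.2) t.1 * Real.exp ((fun l => a t.1 (.inl l)) ⬝ᵥ x.ofLp) : E cout)) i| ≤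
        cin * (η / B) * ‖f y‖ := by
      intro i
      have hcomb : (K x y (f y) - ∑ t : Fin N × Fin cin,
          (Real.exp ((fun l => a t.1 (.inr l)) ⬝ᵥ y.ofLp) * f y t.2) • (WithLp.toLp 2 fun i =>
            c (i, t.2) t.1 * Real.exp ((fun l => a t.1 (.inl l)) ⬝ᵥ x.ofLp) : E cout)) i =
          ∑ j, f y j * (K x y (EuclideanSpace.single j 1) i -
            ∑ k, c (i, j) k * Real.exp (a k ⬝ᵥ u ⟨(x, y), hx, hy⟩)) := by
        have hKf : K x y (f y) i = ∑ j, f y j * K x y (EuclideanSpace.single j 1) i := by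
          conv_lhs => rw [← sum_smul_single (f y)]
          simp only [map_sum, map_smul, WithLp.ofLp_sum, Finset.sum_apply, PiLp.smul_apply,
            smul_eq_mul]
        simp only [mul_sub, Finset.sum_sub_distrib, PiLp.sub_apply,
          WithLp.ofLp_sum, Finset.sum_apply, PiLp.smul_apply, smul_eq_mul, hKf]
        congr 1
        rw [Fintype.sum_prod_type, Finset.sum_comm]
        refine Finset.sum_congr rfl fun j _ => ?_
        rw [Finset.mul_sum]
        refine Finset.sum_congr rfl fun k _ => ?_
        have : a k ⬝ᵥ u ⟨(x, y), hx, hy⟩ =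
            (fun l => a k (.inl l)) ⬝ᵥ x.ofLp + (fun l => a k (.inr l)) ⬝ᵥ y.ofLp := by
          simp [dotProduct, u, Fintype.sum_sum_type]
        rw [this, Real.exp_add]
        ring
      rw [hcomb]
      refine (Finset.abs_sum_le_sum_abs _ _).trans ?_
      calc ∑ j, |f y j * (K x y (EuclideanSpace.single j 1) i -
            ∑ k, c (i, j) k * Real.exp (a k ⬝ᵥ u ⟨(x, y), hx, hy⟩))|
          ≤ ∑ _j : Fin cin, ‖f y‖ * (η / B) := by
            refine Finset.sum_le_sum fun j _ => ?_
            rw [abs_mul, abs_sub_comm]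
            exact mul_le_mul (abs_apply_le_norm _ _) (hc (i, j) ⟨(x, y), hx, hy⟩).le
              (abs_nonneg _) (norm_nonneg _)
        _ = cin * (η / B) * ‖f y‖ := by
            simp
            ring
    refine (Finset.sum_le_sum fun i _ => hcoord i).trans (le_of_eq ?_)
    simp
    ring
  refine (hC _ _ hbound).trans (ENNReal.ofReal_le_ofReal ?_)
  rw [show C * (cout * (cin * (η / B)) * L) = η * ((B - 1) / B) by simp only [B]; ring]
  have : (B - 1) / B ≤ 1 := (div_le_one hB).2 (by linarith)
  nlinarith

/-- Hilbert-Schmidt bound for integral operators with matrix-valued kernel in `L²`. -/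
lemma eLpNorm_two_integral_kernel_le {μ : Measure (E d)} [SFinite μ]
    {D : E d → E d → E cin →L[ℝ] E cout} (hD : MemLp (Function.uncurry D) 2 (μ.prod μ))
    {f : E d → E cin} (hf : MemLp f 2 μ) :
    eLpNorm (fun x => ∫ y, D x y (f y) ∂μ) 2 μ ≤
      eLpNorm (Function.uncurry D) 2 (μ.prod μ) * eLpNorm f 2 μ := by
  have hsq : ∀ {β : Type} [MeasurableSpace β] {G : Type} [NormedAddCommGroup G] (ν : Measure β)
      (g : β → G), eLpNorm g 2 ν = (∫⁻ x, ‖g x‖ₑ ^ (2 : ℝ) ∂ν) ^ (1 / 2 : ℝ) := fun ν g => by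
    rw [eLpNorm_eq_lintegral_rpow_enorm_toReal (by simp) (by simp)]
    simp
  have hpt : ∀ᵐ x ∂μ, ‖∫ y, D x y (f y) ∂μ‖ₑ ^ (2 : ℝ) ≤
      (∫⁻ y, ‖D x y‖ₑ ^ (2 : ℝ) ∂μ) * eLpNorm f 2 μ ^ (2 : ℝ) := by
    filter_upwards [hD.1.prodMk_left] with x hx
    have h1 : ‖∫ y, D x y (f y) ∂μ‖ₑ ≤ eLpNorm (D x) 2 μ * eLpNorm f 2 μ := by
      refine (enorm_integral_le_lintegral_enorm _).trans ?_
      rw [← eLpNorm_one_eq_lintegral_enorm]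
      have := eLpNorm_le_eLpNorm_mul_eLpNorm_of_nnnorm (p := 2) (q := 2) (r := 1) (μ := μ)
        (f := D x) hx hf.1 (fun A v => A v) 1
        (.of_forall fun y => by simpa using (D x y).le_opNNNorm (f y))
      simpa using this
    calc ‖∫ y, D x y (f y) ∂μ‖ₑ ^ (2 : ℝ) ≤ (eLpNorm (D x) 2 μ * eLpNorm f 2 μ) ^ (2 : ℝ) := by
          gcongr
      _ = _ := by
          rw [ENNReal.mul_rpow_of_nonneg _ _ (by norm_num), hsq μ (D x), ← ENNReal.rpow_mul]
          norm_num
  have hfin : eLpNorm f 2 μ ^ (2 : ℝ) ≠ ∞ := ENNReal.rpow_ne_top_of_nonneg (by norm_num) hf.2.ne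
  have hmeas : AEMeasurable (fun z => ‖Function.uncurry D z‖ₑ ^ (2 : ℝ)) (μ.prod μ) :=
    hD.1.enorm.pow_const _
  rw [hsq μ (fun x => ∫ y, D x y (f y) ∂μ), hsq (μ.prod μ), lintegral_prod _ hmeas]
  calc (∫⁻ x, ‖∫ y, D x y (f y) ∂μ‖ₑ ^ (2 : ℝ) ∂μ) ^ (1 / 2 : ℝ)
      ≤ (∫⁻ x, (∫⁻ y, ‖D x y‖ₑ ^ (2 : ℝ) ∂μ) * eLpNorm f 2 μ ^ (2 : ℝ) ∂μ) ^ (1 / 2 : ℝ) := by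
        gcongr ?_ ^ _
        exact lintegral_mono_ae hpt
    _ = _ := by
        rw [lintegral_mul_const' _ _ hfin, ENNReal.mul_rpow_of_nonneg _ _ (by norm_num),
          ← ENNReal.rpow_mul]
        norm_num

lemma ae_integrable_kernel {μ : Measure (E d)} [SFinite μ]
    {D : E d → E d → E cin →L[ℝ] E cout} (hD : MemLp (Function.uncurry D) 2 (μ.prod μ))
    {f : E d → E cin} (hf : MemLp f 2 μ) : ∀ᵐ x ∂μ, Integrable (fun y => D x y (f y)) μ := by
  have h2 : Integrable (fun z : E d × E d => ‖Function.uncurry D z‖ ^ 2) (μ.prod μ) :=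
    hD.integrable_norm_pow (by norm_num)
  filter_upwards [hD.1.prodMk_left, h2.prod_right_ae] with x hx hx2
  have hDx : MemLp (D x) 2 μ :=
    (memLp_two_iff_integrable_sq_norm hx).2 hx2
  exact memLp_one_iff_integrable.1
    ((ContinuousLinearMap.id ℝ (E cin →L[ℝ] E cout)).memLp_of_bilin 1 hDx hf)

lemma aestronglyMeasurable_integral_kernel {μ : Measure (E d)} [SFinite μ]
    {D : E d → E d → E cin →L[ℝ] E cout}
    (hD : AEStronglyMeasurable (Function.uncurry D) (μ.prod μ))
    {f : E d → E cin} (hf : AEStronglyMeasurable f μ) :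
    AEStronglyMeasurable (fun x => ∫ y, D x y (f y) ∂μ) μ :=
  AEStronglyMeasurable.integral_prod_right' (f := fun z : E d × E d => D z.1 z.2 (f z.2))
    ((ContinuousLinearMap.id ℝ (E cin →L[ℝ] E cout)).aestronglyMeasurable_comp₂ hD hf.comp_snd)

/-- Each of the three hypotheses on `T` makes `T` a limit of separable operators with continuous
data, uniformly on bounded sets. -/
lemma exists_sepOp_approx (hΩ : IsCompact Ω) {p q : ℝ≥0∞} [hp : Fact (1 ≤ p)] [hq : Fact (1 ≤ q)]
    (T : Lp (E cin) p (volume.restrict Ω) → Lp (E cout) q (volume.restrict Ω))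
    (hK : HasContinuousKernel T ∨ (2 ≤ p ∧ q ≤ 2 ∧ HasHilbertSchmidtKernel T) ∨
      HasLowRankFactorization T)
    {S : Set (Lp (E cin) p (volume.restrict Ω))} (hS : Bornology.IsBounded S)
    {η : ℝ} (hη : 0 < η) :
    ∃ (ι : Type) (_ : Fintype ι) (A : ι → E d → E cout) (b : ι → E d → ℝ) (j : ι → Fin cin),
      (∀ t, ContinuousOn (A t) Ω) ∧ (∀ t, ContinuousOn (b t) Ω) ∧
      ∀ f ∈ S, eLpNorm (fun x => T f x - sepOp Ω A b j f x) q (volume.restrict Ω)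
          ≤ ENNReal.ofReal η := by
  have := isFiniteMeasure_restrict hΩ
  obtain ⟨R, hR⟩ := exists_eLpNorm_le_of_isBounded hS
  rcases hK with ⟨K, hKc, hKT⟩ | ⟨hp2, hq2, K, hKL, hKT⟩ | hLR
  · obtain ⟨ι, hι, A, b, j, hA, hb, h⟩ := exists_sepOp_of_continuousOn hΩ hKc hp.out q R hη
    refine ⟨ι, hι, A, b, j, hA, hb, fun f hf => ?_⟩
    refine le_of_eq_of_le (eLpNorm_congr_ae ?_) (h f (Lp.memLp f) (hR f hf))
    filter_upwards [hKT f] with x hx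
    rw [hx]
  · -- approximate the kernel in `L²(Ω × Ω)` by a continuous one
    obtain ⟨C₁, hC₁⟩ := exists_eLpNorm_le (μ := volume.restrict Ω) (F := E cin) one_le_two hp2
    obtain ⟨C₂, hC₂⟩ := exists_eLpNorm_le (μ := volume.restrict Ω) (F := E cout) hq.out hq2
    have hδ : 0 < η / 2 / (R * C₁ * C₂ + 1) := by positivity
    obtain ⟨Kc, -, hKKc, hKc, hKcL⟩ := hKL.exists_hasCompactSupport_eLpNorm_sub_le (by simp)
      (ε := ENNReal.ofReal (η / 2 / (R * C₁ * C₂ + 1))) (by simpa using hδ)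
    obtain ⟨ι, hι, A, b, j, hA, hb, h⟩ := exists_sepOp_of_continuousOn
      (K := fun x y => Kc (x, y)) hΩ hKc.continuousOn hp.out q R (half_pos hη)
    refine ⟨ι, hι, A, b, j, hA, hb, fun f hf => ?_⟩
    have hf2 : MemLp f 2 (volume.restrict Ω) := (Lp.memLp f).mono_exponent hp2
    have hfm := Lp.aestronglyMeasurable f
    have hDL : MemLp (Function.uncurry fun x y => K x y - Kc (x, y)) 2
        ((volume.restrict Ω).prod (volume.restrict Ω)) := hKL.sub hKcL
    have hdec : (fun x => T f x - sepOp Ω A b j f x) =ᵐ[volume.restrict Ω]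
        (fun x => ∫ y in Ω, (K x y - Kc (x, y)) (f y)) +
        fun x => (∫ y in Ω, Kc (x, y) (f y)) - sepOp Ω A b j f x := by
      filter_upwards [hKT f, ae_integrable_kernel hKL hf2,
        ae_integrable_kernel (D := fun x y => Kc (x, y)) hKcL hf2] with x hx hi hi'
      rw [hx, Pi.add_apply]
      simp only [sub_apply]
      rw [integral_sub hi hi']
      abel
    rw [eLpNorm_congr_ae hdec]
    refine (eLpNorm_add_le (aestronglyMeasurable_integral_kernel hDL.1 hfm)
      ((aestronglyMeasurable_integral_kernel (D := fun x y => Kc (x, y)) hKcL.1 hfm).sub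
        (aestronglyMeasurable_sepOp hΩ hA b j f)) hq.out).trans ?_
    rw [← add_halves η, ENNReal.ofReal_add (by positivity) (by positivity)]
    refine add_le_add ?_ (h f (Lp.memLp f) (hR f hf))
    refine (hC₂ _ (aestronglyMeasurable_integral_kernel hDL.1 hfm)).trans ?_
    have h1 : eLpNorm f 2 (volume.restrict Ω) ≤ R * C₁ :=
      (hC₁ f hfm).trans (mul_le_mul_left (hR f hf) _)
    calc _ ≤ ENNReal.ofReal (η / 2 / (R * C₁ * C₂ + 1)) * (R * C₁) * C₂ := by
          refine mul_le_mul_left ((eLpNorm_two_integral_kernel_le hDL hf2).trans ?_) _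
          exact mul_le_mul' hKKc h1
      _ ≤ ENNReal.ofReal (η / 2) := by
          rw [← ENNReal.ofReal_coe_nnreal (p := R), ← ENNReal.ofReal_coe_nnreal (p := C₁),
            ← ENNReal.ofReal_coe_nnreal (p := C₂), ← ENNReal.ofReal_mul R.coe_nonneg,
            ← ENNReal.ofReal_mul hδ.le, ← ENNReal.ofReal_mul (by positivity)]
          refine ENNReal.ofReal_le_ofReal ?_
          rw [mul_assoc, div_mul_eq_mul_div, div_le_iff₀ (by positivity)]
          nlinarith
  · obtain ⟨m, Φ, 𝒦, hΦ, h⟩ := hLR S hS η hη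
    refine ⟨Fin m × Fin cin, inferInstance, fun t x => ∑ k, Φ x k • 𝒦 k t.1
      (EuclideanSpace.single t.2 1), fun t y => Φ y t.1, fun t => t.2, fun t => ?_, fun t => ?_,
      fun f hf => ?_⟩
    rotate_left 2
    · have hfi : Integrable f (volume.restrict Ω) :=
        memLp_one_iff_integrable.1 ((Lp.memLp f).mono_exponent hp.out)
      simpa only [lowRank_eq_sepOp hΩ hΦ 𝒦 hfi] using (h f hf).le
    · exact continuousOn_finsetSum _ fun k _ =>
        ((EuclideanSpace.proj (𝕜 := ℝ) k).continuous.comp_continuousOn hΦ).smul continuousOn_const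
    · exact (EuclideanSpace.proj (𝕜 := ℝ) t.1).continuous.comp_continuousOn hΦ

end Separable

/-! ### A one-stage operator that reads off its coefficients and their means -/

/-- Truncation of a real number to `[-M, M]`. -/
def clip (M t : ℝ) : ℝ := max (-M) (min t M)

lemma abs_clip_le {M : ℝ} (hM : 0 ≤ M) (t : ℝ) : |clip M t| ≤ M :=
  abs_le.2 ⟨le_max_left _ _, max_le (by linarith) (min_le_right _ _)⟩

lemma clip_eq_relu {M : ℝ} (hM : 0 ≤ M) (t : ℝ) :
    clip M t = max (t + M) 0 - max (t - M) 0 - M := by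
  unfold clip
  rcases le_total t M with h | h
  · rw [min_eq_left h, max_eq_right (a := t - M) (by linarith)]
    rcases le_total (-M) t with h' | h'
    · rw [max_eq_right h', max_eq_left (by linarith)]
      ring
    · rw [max_eq_left h', max_eq_right (by linarith)]
      ring
  · rw [min_eq_right h, max_eq_right (by linarith), max_eq_left (by linarith),
      max_eq_left (by linarith)]
    ring

lemma abs_sub_clip_le {M : ℝ} (hM : 0 ≤ M) (t : ℝ) : |t - clip M t| ≤ max (|t| - M) 0 := by
  unfold clip
  rcases le_total t M with h | h
  · rw [min_eq_left h]
    rcases le_total (-M) t with h' | h'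
    · rw [max_eq_right h', sub_self, abs_zero]
      exact le_max_right _ _
    · rw [max_eq_left h', abs_of_nonpos (by linarith), abs_of_nonpos (by linarith)]
      exact le_max_of_le_left (by linarith)
  · rw [min_eq_right h, max_eq_right (by linarith), abs_of_nonneg (by linarith),
      abs_of_nonneg (by linarith)]
    exact le_max_left _ _

@[fun_prop]
lemma continuous_clip (M : ℝ) : Continuous (clip M) := by
  unfold clip
  fun_prop

/-- The features `[clip_M (v), sin (2 π η x)]` in which the logits of the mixture weights are
affine. -/
noncomputable def feat {cin d : ℕ} (M η : ℝ) (v : E cin) (x : E d) : Fin cin ⊕ Fin d → ℝ :=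
  Sum.elim (fun j => clip M (v j)) (fun l => Real.sin (2 * Real.pi * (η * x l)))

/-- The Gaussian factor of every channel: all centers are `0` and all scales are
`softplus 0 = log 2`. -/
noncomputable def gauss {d : ℕ} (x : E d) : ℝ :=
  Real.exp (-(1 / 2) * ∑ l, (x l / Real.log 2) ^ 2)

lemma gauss_pos {d : ℕ} (x : E d) : 0 < gauss x := Real.exp_pos _

lemma gauss_le_one {d : ℕ} (x : E d) : gauss x ≤ 1 := by
  refine Real.exp_le_one_iff.2 ?_
  have : 0 ≤ ∑ l, (x l / Real.log 2) ^ 2 := Finset.sum_nonneg fun l _ => sq_nonneg _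
  linarith

lemma continuous_gauss {d : ℕ} : Continuous (gauss : E d → ℝ) := by
  unfold gauss
  fun_prop

lemma softmax_pos {ι : Type*} [Fintype ι] (v : ι → ℝ) (i : ι) : 0 < softmax v i :=
  div_pos (Real.exp_pos _) (Finset.sum_pos (fun _ _ => Real.exp_pos _) ⟨i, Finset.mem_univ i⟩)

lemma sum_softmax {ι : Type*} [Fintype ι] [Nonempty ι] (v : ι → ℝ) : ∑ i, softmax v i = 1 := by
  unfold softmax
  rw [← Finset.sum_div, div_self]
  exact (Finset.sum_pos (fun _ _ => Real.exp_pos _) Finset.univ_nonempty).ne'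

lemma softmax_le_one {ι : Type*} [Fintype ι] (v : ι → ℝ) (i : ι) : softmax v i ≤ 1 := by
  have : Nonempty ι := ⟨i⟩
  rw [← sum_softmax v]
  exact Finset.single_le_sum (f := softmax v) (fun k _ => (softmax_pos v k).le) (Finset.mem_univ i)

/-- Softmax of equal logits is uniform. -/
lemma softmax_zero (n : ℕ) (i : Fin n) : softmax (0 : Fin n → ℝ) i = 1 / n := by
  simp [softmax]

/-- The index in `Fin N` of a channel of the doubled family `Fin (N + N)`. -/
def halfIdx {N : ℕ} : Fin (N + N) → Fin N := Fin.addCases id id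

@[simp] lemma halfIdx_castAdd {N : ℕ} (i : Fin N) : halfIdx (Fin.castAdd N i) = i :=
  Fin.addCases_left i

@[simp] lemma halfIdx_natAdd {N : ℕ} (i : Fin N) : halfIdx (Fin.natAdd N i) = i :=
  Fin.addCases_right i

lemma softmax_halfIdx {N : ℕ} (v : Fin N → ℝ) (g : Fin (N + N)) :
    softmax (fun g => v (halfIdx g)) g = 1 / 2 * softmax v (halfIdx g) := by
  simp only [softmax, Fin.sum_univ_add, halfIdx_castAdd, halfIdx_natAdd]
  rw [← two_mul]
  ring

/-- Free data of the one-stage operators used below: `N` channels with logits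
`⟨a i, feat M η⟩ + b i` (each of them used twice) and a decoder without output bias. -/
structure Channels (d cin cout : ℕ) where
  /-- number of channels, half of the modal budget -/
  N : ℕ
  N_pos : 0 < N
  /-- truncation level of the input field -/
  M : ℝ
  M_nonneg : 0 ≤ M
  /-- frequency of the positional features -/
  η : ℝ
  a : Fin N → Fin cin ⊕ Fin d → ℝ
  b : Fin N → ℝ
  /-- width of the decoder -/
  n : ℕ
  W₁ : Matrix (Fin n) (Fin (N + N)) ℝ
  b₁ : Fin n → ℝ
  W₂ : Matrix (Fin cout) (Fin n) ℝ

/-- Hidden units of the shared encoder layer: `ReLU (v ± M)`, `ReLU (± sin)` and the constant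
`1`. -/
abbrev HiddenIdx (cin d : ℕ) : Type := (Fin cin ⊕ Fin cin) ⊕ (Fin d ⊕ Fin d) ⊕ Unit

namespace Channels

variable {d cin cout : ℕ} (P : Channels d cin cout)

/-- Rows of `W_in`. The frequency with index `0` is zero, so that its cosine is the constant `1`,
which supplies the biases. -/
def inRow : HiddenIdx cin d → Fin cin ⊕ Fin (d + 1) ⊕ Fin (d + 1) → ℝ :=
  Sum.elim
    (Sum.elim (fun j => Sum.elim (Pi.single j 1) (Sum.elim 0 (Pi.single 0 P.M)))
      (fun j => Sum.elim (Pi.single j 1) (Sum.elim 0 (Pi.single 0 (-P.M)))))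
    (Sum.elim
      (Sum.elim (fun l => Sum.elim 0 (Sum.elim (Pi.single l.succ 1) 0))
        (fun l => Sum.elim 0 (Sum.elim (Pi.single l.succ (-1)) 0)))
      (fun _ => Sum.elim 0 (Sum.elim 0 (Pi.single 0 1))))

/-- Rows of `W_w`. -/
def outRow (i : Fin P.N) : HiddenIdx cin d → ℝ :=
  Sum.elim (Sum.elim (fun j => P.a i (.inl j)) (fun j => -P.a i (.inl j)))
    (Sum.elim (Sum.elim (fun l => P.a i (.inr l)) (fun l => -P.a i (.inr l)))
      (fun _ => P.b i - P.M * ∑ j, P.a i (.inl j)))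

/-- The Gaussian particle operator with one stage and one head whose windows and attention weights
are uniform and whose measured values are the coefficients themselves. The read-out adds the mean
of a channel to its first copy and subtracts it from its second copy, so that the decoder can
recover both the coefficient and its mean. -/
noncomputable def params : Params d cin cout (P.N + P.N) where
  freq := d + 1
  B := Matrix.of (Fin.cons 0 fun l => Pi.single l P.η)
  width := Fintype.card (HiddenIdx cin d)
  Win := Matrix.of fun k => P.inRow ((Fintype.equivFin (HiddenIdx cin d)).symm k)
  widthμ := 0
  widthσ := 0
  widthw := Fintype.card (HiddenIdx cin d)
  Uμ := 0
  Wμ := 0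
  Uσ := 0
  Wσ := 0
  Uw := 1
  Ww := Matrix.of fun g k => P.outRow (halfIdx g) ((Fintype.equivFin (HiddenIdx cin d)).symm k)
  heads := 1
  heads_pos := one_pos
  D := P.N + P.N
  D_pos := Nat.add_pos_left P.N_pos _
  proj := 0
  Wp := 0
  Wz := fun _ => 1
  WQ := 0
  WK := 0
  WV := fun _ => 1
  Wout := Matrix.of fun hk => Fin.addCases
    (fun i => if hk.2 = Fin.castAdd P.N i then 1 else 0)
    (fun i => if hk.2 = Fin.castAdd P.N i then -1 else 0)
  lam := 1 / 2
  lam_mem := ⟨by norm_num, by norm_num⟩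
  stab := 1
  stab_pos := one_pos
  stages := 1
  stages_pos := one_pos
  widthDec := P.n
  W₁ := P.W₁
  b₁ := P.b₁
  W₂ := P.W₂
  b₂ := 0

/-- The coefficient of channel `i`, shared by its two copies. -/
noncomputable def coeff (i : Fin P.N) (v : E cin) (x : E d) : ℝ :=
  1 / 2 * softmax (fun k => P.a k ⬝ᵥ feat P.M P.η v x + P.b k) i * gauss x

/-- The mean over the sites of the coefficient of channel `i`. -/
noncomputable def mean (ν : Measure (E d)) (f : E d → E cin) (i : Fin P.N) : ℝ :=
  (∫ x, P.coeff i (f x) x ∂ν) / ν.real Set.univ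

/-- The coefficients after the stage. -/
noncomputable def output (ν : Measure (E d)) (f : E d → E cin) (x : E d) : Fin (P.N + P.N) → ℝ :=
  fun g => gauss x / (gauss x + 2) * Fin.addCases
    (fun i => P.coeff i (f x) x + P.mean ν f i) (fun i => P.coeff i (f x) x - P.mean ν f i) g

lemma coeff_nonneg (i : Fin P.N) (v : E cin) (x : E d) : 0 ≤ P.coeff i v x :=
  mul_nonneg (mul_nonneg (by norm_num) (softmax_pos _ _).le) (gauss_pos x).le

lemma coeff_le_one (i : Fin P.N) (v : E cin) (x : E d) : P.coeff i v x ≤ 1 := by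
  have h1 := softmax_le_one (fun k => P.a k ⬝ᵥ feat P.M P.η v x + P.b k) i
  have h2 := softmax_pos (fun k => P.a k ⬝ᵥ feat P.M P.η v x + P.b k) i
  exact mul_le_one₀ (by linarith) (gauss_pos x).le (gauss_le_one x)

lemma continuous_coeff (i : Fin P.N) :
    Continuous fun z : E cin × E d => P.coeff i z.1 z.2 := by
  have h : ∀ k, Continuous fun z : E cin × E d => P.a k ⬝ᵥ feat P.M P.η z.1 z.2 + P.b k := by
    intro k
    refine (continuous_const.dotProduct (continuous_pi fun s => ?_)).add continuous_const
    rcases s with j | l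
    · simp only [feat, Sum.elim_inl]
      fun_prop
    · simp only [feat, Sum.elim_inr]
      fun_prop
  unfold coeff softmax
  refine (continuous_const.mul ((Real.continuous_exp.comp (h i)).div
    (continuous_finsetSum _ fun k _ => Real.continuous_exp.comp (h k)) fun z => ?_)).mul
    (continuous_gauss.comp continuous_snd)
  exact (Finset.sum_pos (fun _ _ => Real.exp_pos _) ⟨i, Finset.mem_univ i⟩).ne'

lemma aestronglyMeasurable_coeff (i : Fin P.N) {ν : Measure (E d)} {f : E d → E cin}
    (hf : AEStronglyMeasurable f ν) : AEStronglyMeasurable (fun x => P.coeff i (f x) x) ν := by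
  have h := continuous_id.aestronglyMeasurable (μ := ν)
  have h' : AEStronglyMeasurable (fun x => (f x, x)) ν := hf.prodMk h
  have := (P.continuous_coeff i).comp_aestronglyMeasurable h'
  exact this

lemma integrable_coeff (i : Fin P.N) {ν : Measure (E d)} [IsFiniteMeasure ν] {f : E d → E cin}
    (hf : AEStronglyMeasurable f ν) : Integrable (fun x => P.coeff i (f x) x) ν :=
  Integrable.of_bound (P.aestronglyMeasurable_coeff i hf) 1 (.of_forall fun x => by
    rw [Real.norm_of_nonneg (P.coeff_nonneg i _ _)]
    exact P.coeff_le_one i _ _)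

lemma mean_mul_real (ν : Measure (E d)) (f : E d → E cin) (i : Fin P.N) [IsFiniteMeasure ν] :
    ν.real Set.univ * P.mean ν f i = ∫ x, P.coeff i (f x) x ∂ν := by
  rcases eq_or_ne (ν.real Set.univ) 0 with h | h
  · have : ν = 0 := by
      rw [← Measure.measure_univ_eq_zero]
      exact (measureReal_eq_zero_iff (measure_ne_top ν _)).1 h
    simp [this]
  · rw [mean, mul_div_cancel₀ _ h]

lemma abs_mean_le_one {ν : Measure (E d)} [IsFiniteMeasure ν] (f : E d → E cin) (i : Fin P.N) :
    |P.mean ν f i| ≤ 1 := by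
  have h := norm_integral_le_of_norm_le_const (μ := ν) (f := fun x => P.coeff i (f x) x) (C := 1)
    (.of_forall fun x => by
      rw [Real.norm_of_nonneg (P.coeff_nonneg i _ _)]
      exact P.coeff_le_one i _ _)
  rw [one_mul, Real.norm_eq_abs] at h
  rw [mean, abs_div, abs_of_nonneg (measureReal_nonneg (μ := ν) (s := Set.univ))]
  exact div_le_one_of_le₀ h measureReal_nonneg

lemma gauss_ratio_mem {d : ℕ} (x : E d) :
    0 < gauss x / (gauss x + 2) ∧ gauss x / (gauss x + 2) ≤ 1 := by
  have h := gauss_pos x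
  exact ⟨by positivity, (div_le_one (by positivity)).2 (by linarith)⟩

lemma abs_output_le {ν : Measure (E d)} [IsFiniteMeasure ν] (f : E d → E cin) (x : E d)
    (g : Fin (P.N + P.N)) : |P.output ν f x g| ≤ 2 := by
  obtain ⟨h0, h1⟩ := gauss_ratio_mem x
  rw [output, abs_mul, abs_of_pos h0]
  refine (mul_le_of_le_one_left (abs_nonneg _) h1).trans ?_
  have hc : ∀ i, |P.coeff i (f x) x| ≤ 1 := fun i => by
    rw [abs_of_nonneg (P.coeff_nonneg i _ _)]
    exact P.coeff_le_one i _ _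
  refine Fin.addCases (fun i => ?_) (fun i => ?_) g
  · rw [Fin.addCases_left]
    exact (abs_add_le _ _).trans (by linarith [hc i, P.abs_mean_le_one (ν := ν) f i])
  · rw [Fin.addCases_right]
    exact (abs_sub _ _).trans (by linarith [hc i, P.abs_mean_le_one (ν := ν) f i])

lemma aestronglyMeasurable_output {ν : Measure (E d)} {f : E d → E cin}
    (hf : AEStronglyMeasurable f ν) : AEStronglyMeasurable (P.output ν f) ν := by
  refine (aemeasurable_pi_iff.2 fun g => AEStronglyMeasurable.aemeasurable ?_).aestronglyMeasurable
  have hr : AEStronglyMeasurable (fun x : E d => gauss x / (gauss x + 2)) ν :=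
    (continuous_gauss.div (continuous_gauss.add continuous_const)
      fun x => (add_pos (gauss_pos x) two_pos).ne').aestronglyMeasurable
  refine Fin.addCases (fun i => ?_) (fun i => ?_) g
  · simp only [output, Fin.addCases_left]
    exact hr.mul ((P.aestronglyMeasurable_coeff i hf).add aestronglyMeasurable_const)
  · simp only [output, Fin.addCases_right]
    exact hr.mul ((P.aestronglyMeasurable_coeff i hf).sub aestronglyMeasurable_const)

/-! ### The stage in closed form -/

lemma fourier_params (x : E d) : P.params.fourier x = Sum.elim
    (Fin.cons 0 fun l => Real.sin (2 * Real.pi * (P.η * x l)))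
    (Fin.cons 1 fun l => Real.cos (2 * Real.pi * (P.η * x l))) := by
  funext s
  rcases s with k | k <;> refine Fin.cases ?_ (fun l => ?_) k <;>
    simp [Params.fourier, params, Matrix.mulVec, dotProduct, Pi.single_apply]

lemma hidden_params (v : E cin) (x : E d) (s : HiddenIdx cin d) :
    P.params.hidden v x (Fintype.equivFin (HiddenIdx cin d) s) =
      max (P.inRow s ⬝ᵥ Sum.elim (fun i => v i) (P.params.fourier x)) 0 := by
  change max ((P.inRow ((Fintype.equivFin (HiddenIdx cin d)).symm
    (Fintype.equivFin (HiddenIdx cin d) s))) ⬝ᵥ _) 0 = _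
  rw [Equiv.symm_apply_apply]
  rfl

lemma logit_params (v : E cin) (x : E d) (g : Fin (P.N + P.N)) :
    P.params.Ww.mulVec (relu (P.params.Uw.mulVec (P.params.hidden v x))) g =
      P.a (halfIdx g) ⬝ᵥ feat P.M P.η v x + P.b (halfIdx g) := by
  have hUw : relu (P.params.Uw.mulVec (P.params.hidden v x)) = P.params.hidden v x := by
    have h1 : P.params.Uw.mulVec (P.params.hidden v x) = P.params.hidden v x :=
      Matrix.one_mulVec _
    rw [h1]
    funext k
    exact max_eq_left (le_max_right _ _)
  rw [hUw]
  change ∑ k, P.outRow (halfIdx g) ((Fintype.equivFin (HiddenIdx cin d)).symm k) *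
    P.params.hidden v x k = _
  rw [← Equiv.sum_comp (Fintype.equivFin (HiddenIdx cin d))]
  simp only [hidden_params, Equiv.symm_apply_apply, fourier_params]
  have hfeat : feat P.M P.η v x = Sum.elim
      (fun j => max (v j + P.M) 0 - max (v j - P.M) 0 - P.M)
      (fun l => max (Real.sin (2 * Real.pi * (P.η * x l))) 0 -
        max (-Real.sin (2 * Real.pi * (P.η * x l))) 0) := by
    have hmax : ∀ t : ℝ, max t 0 - max (-t) 0 = t := fun t => by
      rcases le_total t 0 with h | h
      · rw [max_eq_right h, max_eq_left (by linarith)]; ring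
      · rw [max_eq_left h, max_eq_right (by linarith)]; ring
    simp only [feat, clip_eq_relu P.M_nonneg, hmax]
  simp only [hfeat, Fintype.sum_sum_type, outRow, inRow, Sum.elim_inl, Sum.elim_inr, dotProduct,
    Pi.single_apply, Pi.zero_apply, zero_mul, Finset.sum_const_zero, ite_mul, one_mul,
    Finset.sum_ite_eq', Finset.mem_univ, if_true, Fin.cons_zero, Fin.cons_succ, zero_add, add_zero,
    mul_one, neg_mul, Finset.univ_unique, Finset.sum_singleton,
    max_eq_left (zero_le_one (α := ℝ)), ← sub_eq_add_neg, Finset.sum_neg_distrib,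
    Finset.sum_mul, mul_sub, Finset.sum_sub_distrib, mul_comm P.M]
  simp only [zero_sub, ← sub_eq_add_neg]
  abel

lemma weight_params (v : E cin) (x : E d) (g : Fin (P.N + P.N)) :
    P.params.weight v x g =
      1 / 2 * softmax (fun k => P.a k ⬝ᵥ feat P.M P.η v x + P.b k) (halfIdx g) := by
  rw [← softmax_halfIdx]
  exact congrArg (fun l => softmax l g) (funext fun g => P.logit_params v x g)

lemma basis_params (v : E cin) (x : E d) (g : Fin (P.N + P.N)) :
    P.params.basis v x g = P.coeff (halfIdx g) v x := by
  have hc : P.params.center v x = 0 := Matrix.zero_mulVec _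
  have hs : P.params.scale v x = fun _ => Real.log 2 := by
    have h0 : P.params.Wσ.mulVec (relu (P.params.Uσ.mulVec (P.params.hidden v x))) = 0 :=
      Matrix.zero_mulVec _
    rw [Params.scale, h0]
    funext _
    simp only [softplus, Pi.zero_apply, Real.exp_zero, one_add_one_eq_two]
  simp only [Params.basis, weight_params, hc, hs, coeff, gauss, Pi.zero_apply, sub_zero]

lemma sum_coeff (v : E cin) (x : E d) : ∑ i, P.coeff i v x = 1 / 2 * gauss x := by
  have : Nonempty (Fin P.N) := ⟨⟨0, P.N_pos⟩⟩
  simp only [coeff]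
  rw [← Finset.sum_mul, ← Finset.mul_sum, sum_softmax, mul_one]

lemma window_params (f : E d → E cin) (Z : E d → Fin (P.N + P.N) → ℝ) (h : Fin P.params.heads)
    (x : E d) (g : Fin (P.N + P.N)) : P.params.window f Z h x g = 1 / (P.N + P.N : ℕ) := by
  rw [← softmax_zero]
  exact congrArg (fun l => softmax l g) (Matrix.zero_mulVec _)

lemma token_params (ν : Measure (E d)) (f : E d → E cin) (h : Fin P.params.heads)
    (g k : Fin (P.N + P.N)) :
    P.params.token ν f (fun x => P.params.basis (f x) x) h g k = P.mean ν f (halfIdx k) := by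
  have hN : ((P.N + P.N : ℕ) : ℝ) ≠ 0 := by
    have := P.N_pos
    exact_mod_cast (by omega : P.N + P.N ≠ 0)
  have hW : ∀ z : Fin (P.N + P.N) → ℝ, (P.params.Wz h).vecMul z = z := fun z => Matrix.vecMul_one z
  simp only [Params.token, window_params]
  change (∫ x, 1 / ((P.N + P.N : ℕ) : ℝ) *
    ((P.params.Wz h).vecMul (P.params.basis (f x) x)) k ∂ν) / _ = _
  simp only [hW, basis_params]
  rw [integral_const_mul, integral_const, smul_eq_mul, mean, mul_comm (ν.real _),
    mul_div_mul_left _ _ (one_div_ne_zero hN)]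

lemma couple_params (h : Fin P.params.heads) (T : Matrix (Fin (P.N + P.N)) (Fin P.params.D) ℝ)
    (m : Fin P.params.D → ℝ) (hT : ∀ g k, T g k = m k) (g : Fin (P.N + P.N))
    (k : Fin P.params.D) :
    P.params.couple h T g k = m k := by
  have hN : ((P.N + P.N : ℕ) : ℝ) ≠ 0 := by
    have := P.N_pos
    exact_mod_cast (by omega : P.N + P.N ≠ 0)
  have hlogit : (fun g' => ((T * P.params.WQ h) * (T * P.params.WK h).transpose) g g' /
      Real.sqrt P.params.D) = 0 := by
    have : T * P.params.WQ h = 0 := Matrix.mul_zero _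
    funext g'
    rw [this, Matrix.zero_mul]
    simp
  have hV : T * P.params.WV h = T := Matrix.mul_one _
  rw [Params.couple, hV, Matrix.mul_apply]
  simp only [Matrix.of_apply, hlogit]
  have hsm : ∀ g', softmax (0 : Fin (P.N + P.N) → ℝ) g' = 1 / (P.N + P.N : ℕ) := softmax_zero _
  simp only [hsm, hT, Finset.sum_const, Finset.card_univ, Fintype.card_fin, nsmul_eq_mul]
  field_simp

lemma scatter_params (ν : Measure (E d)) (f : E d → E cin) (x : E d) (g : Fin (P.N + P.N)) :
    P.params.scatter ν f (fun x => P.params.basis (f x) x) x g =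
      Fin.addCases (fun i => P.mean ν f i) (fun i => -P.mean ν f i) g := by
  have hN : ((P.N + P.N : ℕ) : ℝ) ≠ 0 := by
    have := P.N_pos
    exact_mod_cast (by omega : P.N + P.N ≠ 0)
  have hU : ∀ h g k, P.params.couple h (P.params.token ν f (fun x => P.params.basis (f x) x) h) g k
      = P.mean ν f (halfIdx k) := fun h =>
    P.couple_params h _ (fun k => P.mean ν f (halfIdx k)) (P.token_params ν f h)
  have hs : ∀ hk : Fin P.params.heads × Fin P.params.D,
      ∑ g, P.params.window f (fun x => P.params.basis (f x) x) hk.1 x g *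
      P.params.couple hk.1 (P.params.token ν f (fun x => P.params.basis (f x) x) hk.1) g hk.2 =
      P.mean ν f (halfIdx (N := P.N) hk.2) := by
    intro hk
    simp only [hU, window_params, Finset.sum_const, Finset.card_univ, Fintype.card_fin,
      nsmul_eq_mul]
    field_simp
  rw [Params.scatter]
  simp only [hs]
  change ∑ hk : Fin 1 × Fin (P.N + P.N), P.mean ν f (halfIdx hk.2) *
    (Fin.addCases (fun i => if hk.2 = Fin.castAdd P.N i then (1 : ℝ) else 0)
    (fun i => if hk.2 = Fin.castAdd P.N i then -1 else 0) g) = _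
  rw [Fintype.sum_prod_type, Finset.univ_unique, Finset.sum_singleton]
  refine Fin.addCases (fun i => ?_) (fun i => ?_) g
  · simp only [Fin.addCases_left, mul_ite, mul_one, mul_zero, Finset.sum_ite_eq',
      Finset.mem_univ, if_true, halfIdx_castAdd]
  · simp only [Fin.addCases_right, mul_ite, mul_neg, mul_one, mul_zero, Finset.sum_ite_eq',
      Finset.mem_univ, if_true, halfIdx_castAdd]

/-- The read-out is balanced: the means cancel in the sum over the channels. -/
lemma sum_mixed_params (ν : Measure (E d)) (f : E d → E cin) (x : E d) :
    ∑ g, P.params.mixed ν f (fun x => P.params.basis (f x) x) x g = 1 / 2 * gauss x := by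
  have hlam : P.params.lam = 1 / 2 := rfl
  simp only [Params.mixed, scatter_params, basis_params, hlam, Fin.sum_univ_add, halfIdx_castAdd,
    halfIdx_natAdd, Fin.addCases_left, Fin.addCases_right, Finset.sum_add_distrib,
    ← Finset.mul_sum, sum_coeff, Finset.sum_neg_distrib]
  ring

lemma stage_params (ν : Measure (E d)) (f : E d → E cin) (x : E d) :
    P.params.stage ν f (fun x => P.params.basis (f x) x) x = P.output ν f x := by
  have hlam : P.params.lam = 1 / 2 := rfl
  have hstab : P.params.stab = 1 := rfl
  have hpos := gauss_pos x
  funext g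
  have hsum : ∑ g, P.params.basis (f x) x g = gauss x := by
    simp only [basis_params, Fin.sum_univ_add, halfIdx_castAdd, halfIdx_natAdd, sum_coeff]
    ring
  have hratio : gauss x / (1 / 2 * gauss x + 1) = 2 * (gauss x / (gauss x + 2)) := by
    field_simp
  rw [Params.stage, sum_mixed_params, hsum, hstab, hratio]
  simp only [Params.mixed, scatter_params, basis_params, hlam, output]
  refine Fin.addCases (fun i => ?_) (fun i => ?_) g
  · simp only [halfIdx_castAdd, Fin.addCases_left]
    ring
  · simp only [halfIdx_natAdd, Fin.addCases_right]
    ring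

lemma eval_params (ν : Measure (E d)) (f : E d → E cin) (x : E d) :
    P.params.eval ν f x = P.params.decode (P.output ν f x) :=
  congrArg P.params.decode (P.stage_params ν f x)

lemma decode_params_apply (y : Fin (P.N + P.N) → ℝ) (i : Fin cout) :
    P.params.decode y i = ∑ k, P.W₂ i k * max (P.W₁ k ⬝ᵥ y + P.b₁ k) 0 :=
  add_zero _

lemma wellDefinedAt_params {ν : Measure (E d)} [IsFiniteMeasure ν] {f : E d → E cin}
    (hf : AEStronglyMeasurable f ν) : P.params.WellDefinedAt ν f := by
  intro k hk
  obtain rfl : k = 0 := Nat.lt_one_iff.1 hk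
  refine ⟨fun g => ?_, .of_forall fun x => ?_⟩
  · change Integrable (fun x => P.params.basis (f x) x g) ν
    simp only [basis_params]
    exact P.integrable_coeff _ hf
  · change (∑ g, P.params.mixed ν f (fun x => P.params.basis (f x) x) x g) + 1 ≠ 0
    rw [sum_mixed_params]
    exact (by linarith [gauss_pos x] : 0 < 1 / 2 * gauss x + 1).ne'

lemma memLp_eval_params {ν : Measure (E d)} [IsFiniteMeasure ν] {f : E d → E cin}
    (hf : AEStronglyMeasurable f ν) (q : ℝ≥0∞) : MemLp (P.params.eval ν f) q ν := by
  have hcont : Continuous P.params.decode := by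
    refine (PiLp.continuous_toLp 2 _).comp (continuous_pi fun i => ?_)
    refine Continuous.add (continuous_const.dotProduct (continuous_pi fun k => ?_))
      continuous_const
    exact ((continuous_const.dotProduct continuous_id).add continuous_const).max continuous_const
  obtain ⟨C, hC⟩ := (isCompact_Icc (a := fun _ : Fin (P.N + P.N) => (-2 : ℝ))
    (b := fun _ => 2)).exists_bound_of_continuousOn hcont.continuousOn
  have heq : P.params.eval ν f = fun x => P.params.decode (P.output ν f x) :=
    funext (P.eval_params ν f)
  rw [heq]
  refine MemLp.of_bound (hcont.comp_aestronglyMeasurable (P.aestronglyMeasurable_output hf)) C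
    (.of_forall fun x => hC _ ⟨fun g => ?_, fun g => ?_⟩)
  · exact (abs_le.1 (P.abs_output_le f x g)).1
  · exact (abs_le.1 (P.abs_output_le f x g)).2

end Channels

/-! ### Approximation of separable operators -/

section Approximation

variable {d cin cout : ℕ} {Ω : Set (E d)}

/-- At a small frequency the sine is injective on the coordinates of the points of `Ω`. -/
lemma exists_frequency (hΩ : IsCompact Ω) : ∃ η : ℝ, ∀ x ∈ Ω, ∀ y ∈ Ω,
    (∀ l, Real.sin (2 * Real.pi * (η * x l)) = Real.sin (2 * Real.pi * (η * y l))) → x = y := by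
  obtain ⟨C, hC⟩ := hΩ.isBounded.exists_norm_le
  have hη : 0 < 1 / (4 * (|C| + 1)) := by positivity
  refine ⟨1 / (4 * (|C| + 1)), fun x hx y hy h => ?_⟩
  have hmem : ∀ z ∈ Ω, ∀ l, 2 * Real.pi * (1 / (4 * (|C| + 1)) * z l) ∈
      Set.Icc (-(Real.pi / 2)) (Real.pi / 2) := by
    intro z hz l
    have hzl : |z l| ≤ |C| + 1 := by
      linarith [abs_apply_le_norm z l, hC z hz, le_abs_self C]
    rw [Set.mem_Icc, ← abs_le, abs_mul (2 * Real.pi), abs_mul (1 / _), abs_of_pos hη,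
      abs_of_pos (by positivity : 0 < 2 * Real.pi)]
    calc 2 * Real.pi * (1 / (4 * (|C| + 1)) * |z l|)
        ≤ 2 * Real.pi * (1 / (4 * (|C| + 1)) * (|C| + 1)) := by gcongr
      _ = Real.pi / 2 := by
          field_simp
          ring
  refine PiLp.ext fun l => ?_
  have := Real.injOn_sin (hmem x hx l) (hmem y hy l) (h l)
  have h2 : (2 * Real.pi * (1 / (4 * (|C| + 1)))) ≠ 0 := by positivity
  rw [← mul_assoc, ← mul_assoc] at this
  exact mul_left_cancel₀ h2 this

/-- Combinations of the channels approximate both the integrands `b t · clip_M f_{j t}` and, after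
the factor `ρ ^ 2` of the decoder inputs, the output fields `A t`. The Gaussian factor and `ρ` are
bounded below on the compact set `Ω`, so they are divided out before the density of the softmax
channels is used. -/
lemma exists_channels {ι : Type} [Fintype ι] (hΩ : IsCompact Ω) {A : ι → E d → E cout}
    (hA : ∀ t, ContinuousOn (A t) Ω) {b : ι → E d → ℝ} (hb : ∀ t, ContinuousOn (b t) Ω)
    (j : ι → Fin cin) {M : ℝ} (hM : 0 ≤ M) {δ : ℝ} (hδ : 0 < δ) :
    ∃ (P : Channels d cin cout) (β : ι → Fin P.N → ℝ) (α : ι → Fin cout → Fin P.N → ℝ),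
      ∀ (v : E cin), ∀ x ∈ Ω,
        (∀ t, |∑ i, β t i * P.coeff i v x - b t x * clip M (v (j t))| ≤ δ) ∧
        ∀ t k, |(gauss x / (gauss x + 2)) ^ 2 * ∑ i, α t k i * P.coeff i v x - A t x k| ≤ δ := by
  obtain ⟨η, hη⟩ := exists_frequency hΩ
  let X : Set ((Fin cin → ℝ) × E d) := Set.Icc (fun _ => -M) (fun _ => M) ×ˢ Ω
  have : CompactSpace X := isCompact_iff_compactSpace.1 (isCompact_Icc.prod hΩ)
  let u : X → Fin cin ⊕ Fin d → ℝ := fun z =>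
    Sum.elim (fun i => z.1.1 i) (fun l => Real.sin (2 * Real.pi * (η * z.1.2 l)))
  have hu : Continuous u := by
    refine continuous_pi fun s => ?_
    rcases s with i | l
    · simp only [u, Sum.elim_inl]
      fun_prop
    · simp only [u, Sum.elim_inr]
      fun_prop
  have hinj : Function.Injective u := by
    intro z z' h
    refine Subtype.ext (Prod.ext (funext fun i => congrFun h (Sum.inl i))
      (hη _ z.2.2 _ z'.2.2 fun l => congrFun h (Sum.inr l)))
  have hx : Continuous fun z : X => z.1.2 := continuous_snd.comp continuous_subtype_val
  have hg : Continuous fun z : X => gauss z.1.2 := continuous_gauss.comp hx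
  have hbc : ∀ t, Continuous fun z : X => b t z.1.2 := fun t =>
    (hb t).comp_continuous hx fun z => z.2.2
  have hAc : ∀ t k, Continuous fun z : X => A t z.1.2 k := fun t k =>
    (EuclideanSpace.proj (𝕜 := ℝ) k).continuous.comp ((hA t).comp_continuous hx fun z => z.2.2)
  have hcc : ∀ i, Continuous fun z : X => z.1.1 i := fun i =>
    (continuous_apply i).comp (continuous_fst.comp continuous_subtype_val)
  let h : ι ⊕ ι × Fin cout → C(X, ℝ) := Sum.elim
    (fun t => ⟨fun z => 2 * (b t z.1.2 * z.1.1 (j t)) / gauss z.1.2,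
      (continuous_const.mul ((hbc t).mul (hcc (j t)))).div hg fun z => (gauss_pos _).ne'⟩)
    (fun tk => ⟨fun z => 2 * A tk.1 z.1.2 tk.2 /
        (gauss z.1.2 * (gauss z.1.2 / (gauss z.1.2 + 2)) ^ 2),
      (continuous_const.mul (hAc _ _)).div (hg.mul ((hg.div (hg.add continuous_const)
        fun z => (add_pos (gauss_pos _) two_pos).ne').pow 2)) fun z =>
        (mul_pos (gauss_pos _) (pow_pos (Channels.gauss_ratio_mem _).1 2)).ne'⟩)
  obtain ⟨N, hN, a, b', c, hc⟩ := exists_softmax_approx u hu hinj h hδ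
  refine ⟨⟨N, hN, M, hM, η, a, b', 0, 0, 0, 0⟩, fun t => c (.inl t), fun t k => c (.inr (t, k)),
    fun v x hxΩ => ?_⟩
  have hv : (fun i => clip M (v i), x) ∈ X :=
    ⟨⟨fun i => (abs_le.1 (abs_clip_le hM _)).1, fun i => (abs_le.1 (abs_clip_le hM _)).2⟩, hxΩ⟩
  have hg0 := gauss_pos x
  have hg1 := gauss_le_one x
  obtain ⟨hr0, hr1⟩ := Channels.gauss_ratio_mem x
  -- an error of the softmax channels is multiplied by a factor in `[0, 1]`
  have hscale : ∀ (w : Fin N → ℝ) (H F s : ℝ), 0 ≤ s → s ≤ 1 → H * (1 / 2 * gauss x * s) = F →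
      |∑ i, w i * softmax (fun k => a k ⬝ᵥ feat M η v x + b' k) i - H| < δ →
      |s * ∑ i, w i * (1 / 2 * softmax (fun k => a k ⬝ᵥ feat M η v x + b' k) i * gauss x) - F|
        ≤ δ := by
    intro w H F s hs0 hs1 hHF hlt
    have heq : s * ∑ i, w i * (1 / 2 * softmax (fun k => a k ⬝ᵥ feat M η v x + b' k) i * gauss x)
        - F = (1 / 2 * gauss x * s) *
        (∑ i, w i * softmax (fun k => a k ⬝ᵥ feat M η v x + b' k) i - H) := by
      rw [← hHF, mul_sub, Finset.mul_sum, Finset.mul_sum]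
      congr 1
      · exact Finset.sum_congr rfl fun i _ => by ring
      · ring
    have hfac : 1 / 2 * gauss x * s ≤ 1 := by nlinarith
    rw [heq, abs_mul, abs_of_nonneg (by positivity)]
    exact (mul_le_of_le_one_left (abs_nonneg _) hfac).trans hlt.le
  refine ⟨fun t => ?_, fun t k => ?_⟩
  · have := hscale (c (.inl t)) (2 * (b t x * clip M (v (j t))) / gauss x)
      (b t x * clip M (v (j t))) 1 zero_le_one le_rfl (by field_simp) (hc (.inl t) ⟨_, hv⟩)
    rwa [one_mul] at this
  · exact hscale (c (.inr (t, k))) (2 * A t x k / (gauss x * (gauss x / (gauss x + 2)) ^ 2))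
      (A t x k) ((gauss x / (gauss x + 2)) ^ 2) (sq_nonneg _) (pow_le_one₀ hr0.le hr1)
      (by field_simp) (hc (.inr (t, k)) ⟨_, hv⟩)

/-- Adding a decoder: for given combinations `β`, `α` of the channels, the output of the operator is
uniformly close to the sum over `t` of the products of the measurements `∫ ∑ i, β t i coeff i` with
the fields `ρ ^ 2 ∑ i, α t k i coeff i`. The sums and differences of the two copies of a channel
are `2 ρ` times its coefficient and its mean. -/
lemma exists_decoder {ι : Type} [Fintype ι] (P : Channels d cin cout) (ν : Measure (E d))
    [IsFiniteMeasure ν] (β : ι → Fin P.N → ℝ) (α : ι → Fin cout → Fin P.N → ℝ) {δ : ℝ}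
    (hδ : 0 < δ) :
    ∃ Q : Channels d cin cout, ∀ f : E d → E cin, AEStronglyMeasurable f ν → ∀ x k,
      |Q.params.decode (Q.output ν f x) k - ∑ t, (∫ y, ∑ i, β t i * P.coeff i (f y) y ∂ν) *
        ((gauss x / (gauss x + 2)) ^ 2 * ∑ i, α t k i * P.coeff i (f x) x)| ≤ δ := by
  obtain ⟨n, a, b, c, h⟩ := exists_relu_approx_bilinear
    (fun t k => (Fin.addCases (fun i => α t k i / 2) (fun i => α t k i / 2) :
      Fin (P.N + P.N) → ℝ))
    (fun t => (Fin.addCases (fun i => ν.real Set.univ * β t i / 2)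
      (fun i => -(ν.real Set.univ * β t i / 2)) : Fin (P.N + P.N) → ℝ)) 2 hδ
  refine ⟨⟨P.N, P.N_pos, P.M, P.M_nonneg, P.η, P.a, P.b, n, Matrix.of a, b, Matrix.of c⟩,
    fun f hf x k => ?_⟩
  rw [Channels.decode_params_apply]
  have hlt := h (P.output ν f x) (P.abs_output_le f x) k
  refine le_of_eq_of_le ?_ hlt.le
  congr 2
  refine Finset.sum_congr rfl fun t _ => ?_
  have hm : ∫ y, ∑ i, β t i * P.coeff i (f y) y ∂ν =
      ∑ i, ν.real Set.univ * β t i * P.mean ν f i := by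
    rw [integral_finsetSum _ fun i _ => (P.integrable_coeff i hf).const_mul _]
    refine Finset.sum_congr rfl fun i _ => ?_
    rw [integral_const_mul, ← P.mean_mul_real]
    ring
  rw [hm]
  simp only [dotProduct, Fin.sum_univ_add, Fin.addCases_left, Fin.addCases_right,
    Channels.output, ← Finset.sum_add_distrib]
  have e1 : ∀ i, α t k i / 2 * (gauss x / (gauss x + 2) * (P.coeff i (f x) x + P.mean ν f i)) +
      α t k i / 2 * (gauss x / (gauss x + 2) * (P.coeff i (f x) x - P.mean ν f i)) =
      gauss x / (gauss x + 2) * (α t k i * P.coeff i (f x) x) := fun i => by ring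
  have e2 : ∀ i, ν.real Set.univ * β t i / 2 *
      (gauss x / (gauss x + 2) * (P.coeff i (f x) x + P.mean ν f i)) +
      -(ν.real Set.univ * β t i / 2) *
      (gauss x / (gauss x + 2) * (P.coeff i (f x) x - P.mean ν f i)) =
      gauss x / (gauss x + 2) * (ν.real Set.univ * β t i * P.mean ν f i) := fun i => by ring
  simp only [e1, e2, ← Finset.mul_sum]
  ring

lemma abs_mul_sub_mul_le {p q A m C₁ C₂ δ₁ δ₂ : ℝ} (hA : |A| ≤ C₁) (hm : |m| ≤ C₂)
    (hp : |p - A| ≤ δ₁) (hq : |q - m| ≤ δ₂) :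
    |q * p - m * A| ≤ δ₁ * (C₂ + δ₂) + C₁ * δ₂ := by
  have hq' : |q| ≤ C₂ + δ₂ := by
    calc |q| = |m + (q - m)| := by ring_nf
      _ ≤ |m| + |q - m| := abs_add_le _ _
      _ ≤ _ := add_le_add hm hq
  calc |q * p - m * A| = |(p - A) * q + A * (q - m)| := by ring_nf
    _ ≤ |p - A| * |q| + |A| * |q - m| := (abs_add_le _ _).trans (by rw [abs_mul, abs_mul])
    _ ≤ _ := add_le_add
      (mul_le_mul hp hq' (abs_nonneg _) ((abs_nonneg _).trans hp))
      (mul_le_mul hA hq (abs_nonneg _) ((abs_nonneg _).trans hA))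

lemma exists_common_bound {ι : Type*} [Finite ι] {F : Type*} [NormedAddCommGroup F]
    (hΩ : IsCompact Ω) {g : ι → E d → F} (hg : ∀ t, ContinuousOn (g t) Ω) :
    ∃ C : ℝ, 0 ≤ C ∧ ∀ t, ∀ x ∈ Ω, ‖g t x‖ ≤ C := by
  cases nonempty_fintype ι
  choose C hC using fun t => hΩ.exists_bound_of_continuousOn (hg t)
  refine ⟨∑ t, |C t|, Finset.sum_nonneg fun t _ => abs_nonneg _, fun t x hx => ?_⟩
  exact ((hC t x hx).trans (le_abs_self _)).trans
    (Finset.single_le_sum (f := fun t => |C t|) (fun t _ => abs_nonneg _) (Finset.mem_univ t))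

/-- Replacing `f_j` by its truncation and the integrand by a `δ`-approximation changes a
measurement by at most the truncation error plus `δ |Ω|`. -/
lemma abs_integral_approx_sub_le (hΩ : IsCompact Ω) {f : E d → E cin}
    (hf : Integrable f (volume.restrict Ω)) (j : Fin cin) {b : E d → ℝ} (hb : ContinuousOn b Ω)
    {C : ℝ} (hC : ∀ x ∈ Ω, |b x| ≤ C) {M δ δ' : ℝ} (hM : 0 ≤ M) (hδ' : 0 ≤ δ') {r : E d → ℝ}
    (hr : Integrable r (volume.restrict Ω)) (hC0 : 0 ≤ C)
    (happ : ∀ x ∈ Ω, |r x - b x * clip M (f x j)| ≤ δ)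
    (htail : ∫⁻ x in Ω, ENNReal.ofReal (‖f x‖ - M) ≤ ENNReal.ofReal δ') :
    |(∫ x in Ω, r x) - ∫ x in Ω, b x * f x j| ≤ C * δ' + δ * (volume.restrict Ω).real Set.univ := by
  have := isFiniteMeasure_restrict hΩ
  have hbf : Integrable (fun x => b x * f x j) (volume.restrict Ω) :=
    IntegrableOn.continuousOn_mul hb (integrable_apply hf j) hΩ
  have htailm : AEStronglyMeasurable (fun x => max (‖f x‖ - M) 0) (volume.restrict Ω) :=
    Continuous.comp_aestronglyMeasurable (g := fun t : ℝ => max (t - M) 0) (by fun_prop) hf.1.norm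
  have htaili : Integrable (fun x => max (‖f x‖ - M) 0) (volume.restrict Ω) := by
    refine hf.norm.mono' htailm (.of_forall fun x => ?_)
    rw [Real.norm_of_nonneg (le_max_right _ _)]
    exact max_le (by linarith) (norm_nonneg _)
  have htail' : ∫ x in Ω, max (‖f x‖ - M) 0 ≤ δ' := by
    rw [integral_eq_lintegral_of_nonneg_ae (f := fun x => max (‖f x‖ - M) 0)
      (.of_forall fun x => le_max_right _ _) htailm]
    refine ENNReal.toReal_le_of_le_ofReal hδ' (le_of_eq_of_le ?_ htail)
    simp [ENNReal.ofReal_max]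
  rw [← integral_sub hr hbf, ← Real.norm_eq_abs]
  refine (norm_integral_le_integral_norm _).trans ?_
  calc ∫ x in Ω, ‖r x - b x * f x j‖ ≤ ∫ x in Ω, (C * max (‖f x‖ - M) 0 + δ) := by
        refine integral_mono_of_nonneg (.of_forall fun x => norm_nonneg _)
          ((htaili.const_mul C).add (integrable_const δ))
          (ae_restrict_of_forall_mem hΩ.measurableSet fun x hx => ?_)
        have hclip : |f x j - clip M (f x j)| ≤ max (‖f x‖ - M) 0 :=
          (abs_sub_clip_le hM _).trans
            (max_le_max (sub_le_sub_right (abs_apply_le_norm _ _) _) le_rfl)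
        calc ‖r x - b x * f x j‖
            = |(r x - b x * clip M (f x j)) - b x * (f x j - clip M (f x j))| := by
              rw [Real.norm_eq_abs]
              ring_nf
          _ ≤ |r x - b x * clip M (f x j)| + |b x| * |f x j - clip M (f x j)| :=
              (abs_sub _ _).trans (by rw [abs_mul])
          _ ≤ δ + C * max (‖f x‖ - M) 0 :=
              add_le_add (happ x hx) (mul_le_mul (hC x hx) hclip (abs_nonneg _) hC0)
          _ = _ := add_comm _ _
    _ = C * (∫ x in Ω, max (‖f x‖ - M) 0) + δ * (volume.restrict Ω).real Set.univ := by
        rw [integral_add (htaili.const_mul C) (integrable_const δ), integral_const_mul,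
          integral_const, smul_eq_mul, mul_comm δ]
    _ ≤ _ := by gcongr

/-- Separable operators are approximated uniformly on `Ω` and on every uniformly integrable set of
input fields. -/
lemma exists_channels_near_sepOp {ι : Type} [Fintype ι] (hΩ : IsCompact Ω) {A : ι → E d → E cout}
    (hA : ∀ t, ContinuousOn (A t) Ω) {b : ι → E d → ℝ} (hb : ∀ t, ContinuousOn (b t) Ω)
    (j : ι → Fin cin) {𝓕 : Set (E d → E cin)} {L : ℝ} (hL0 : 0 ≤ L)
    (hint : ∀ f ∈ 𝓕, Integrable f (volume.restrict Ω))
    (hL : ∀ f ∈ 𝓕, ∫ x in Ω, ‖f x‖ ≤ L)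
    (htail : ∀ δ : ℝ, 0 < δ → ∃ M : ℝ, 0 < M ∧ ∀ f ∈ 𝓕,
      ∫⁻ x in Ω, ENNReal.ofReal (‖f x‖ - M) ≤ ENNReal.ofReal δ) {η : ℝ} (hη : 0 < η) :
    ∃ Q : Channels d cin cout, ∀ f ∈ 𝓕, ∀ x ∈ Ω,
      ‖Q.params.eval (volume.restrict Ω) f x - sepOp Ω A b j f x‖ ≤ η := by
  have := isFiniteMeasure_restrict hΩ
  obtain ⟨C₁, hC₁0, hC₁⟩ := exists_common_bound hΩ hA
  obtain ⟨C₂, hC₂0, hC₂⟩ := exists_common_bound hΩ hb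
  set V : ℝ := (volume.restrict Ω).real Set.univ with hV
  have hV0 : 0 ≤ V := measureReal_nonneg
  -- the error per term is at most `K` times the common accuracy `δ ≤ 1` of all approximations
  set K : ℝ := C₂ * L + (C₂ + V) * (1 + C₁) with hK
  have hK0 : 0 ≤ K := by positivity
  set δ : ℝ := min 1 (η / (cout * (Fintype.card ι * K + 1) + 1)) with hδdef
  have hδ : 0 < δ := lt_min one_pos (by positivity)
  have hδ1 : δ ≤ 1 := min_le_left _ _
  have hδη : cout * (δ * (Fintype.card ι * K + 1)) ≤ η := by
    have h1 : δ ≤ η / (cout * (Fintype.card ι * K + 1) + 1) := min_le_right _ _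
    rw [le_div_iff₀ (by positivity)] at h1
    nlinarith
  obtain ⟨M, hM, hMt⟩ := htail δ hδ
  obtain ⟨P, β, α, hP⟩ := exists_channels hΩ hA hb j hM.le hδ
  obtain ⟨Q, hQ⟩ := exists_decoder P (volume.restrict Ω) β α hδ
  refine ⟨Q, fun f hf x hx => ?_⟩
  have hfi := hint f hf
  rw [Q.eval_params]
  refine (norm_le_sum_abs _).trans ?_
  have hcoord : ∀ k, |(Q.params.decode (Q.output (volume.restrict Ω) f x) -
      sepOp Ω A b j f x) k| ≤ δ * (Fintype.card ι * K + 1) := by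
    intro k
    have hterm : ∀ t, |(∫ y in Ω, ∑ i, β t i * P.coeff i (f y) y) *
        ((gauss x / (gauss x + 2)) ^ 2 * ∑ i, α t k i * P.coeff i (f x) x) -
        (∫ y in Ω, b t y * f y (j t)) * A t x k| ≤ δ * K := by
      intro t
      have hm : |∫ y in Ω, b t y * f y (j t)| ≤ C₂ * L := by
        rw [← Real.norm_eq_abs]
        refine (norm_integral_le_integral_norm _).trans ?_
        refine le_trans ?_ (mul_le_mul_of_nonneg_left (hL f hf) hC₂0)
        rw [← integral_const_mul]
        refine integral_mono_of_nonneg (.of_forall fun y => norm_nonneg _)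
          (hfi.norm.const_mul _) (ae_restrict_of_forall_mem hΩ.measurableSet fun y hy => ?_)
        beta_reduce
        rw [norm_mul]
        exact mul_le_mul (hC₂ t y hy) (abs_apply_le_norm _ _) (norm_nonneg _) hC₂0
      have hq := abs_integral_approx_sub_le hΩ hfi (j t) (hb t) (hC₂ t) hM.le hδ.le
        (r := fun y => ∑ i, β t i * P.coeff i (f y) y)
        (integrable_finsetSum _ fun i _ => (P.integrable_coeff i hfi.1).const_mul _) hC₂0
        (fun y hy => (hP (f y) y hy).1 t) (hMt f hf)
      have hAk : |A t x k| ≤ C₁ := (abs_apply_le_norm _ _).trans (hC₁ t x hx)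
      refine (abs_mul_sub_mul_le hAk hm ((hP (f x) x hx).2 t k) hq).trans ?_
      rw [← hV]
      have : δ * (C₂ * δ + δ * V) ≤ δ * (C₂ + V) := by
        refine mul_le_mul_of_nonneg_left ?_ hδ.le
        nlinarith
      calc δ * (C₂ * L + (C₂ * δ + δ * V)) + C₁ * (C₂ * δ + δ * V)
          = δ * (C₂ * L) + δ * (C₂ * δ + δ * V) + C₁ * (C₂ * δ + δ * V) := by ring
        _ ≤ δ * (C₂ * L) + δ * (C₂ + V) + C₁ * (C₂ * δ + δ * V) := by linarith
        _ = δ * K := by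
            rw [hK]
            ring
    have hsep : sepOp Ω A b j f x k = ∑ t, (∫ y in Ω, b t y * f y (j t)) * A t x k := by
      simp [sepOp]
    rw [PiLp.sub_apply, hsep]
    have hdec := hQ f hfi.1 x k
    have hsum : |∑ t, (∫ y in Ω, ∑ i, β t i * P.coeff i (f y) y) *
        ((gauss x / (gauss x + 2)) ^ 2 * ∑ i, α t k i * P.coeff i (f x) x) -
        ∑ t, (∫ y in Ω, b t y * f y (j t)) * A t x k| ≤ Fintype.card ι * (δ * K) := by
      rw [← Finset.sum_sub_distrib]
      refine (Finset.abs_sum_le_sum_abs _ _).trans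
        ((Finset.sum_le_sum fun t _ => hterm t).trans (le_of_eq ?_))
      simp
    refine (abs_sub_le _ _ _).trans ((add_le_add hdec hsum).trans (le_of_eq ?_))
    ring
  refine (Finset.sum_le_sum fun k _ => hcoord k).trans (le_trans (le_of_eq ?_) hδη)
  simp

end Approximation

end GPO

theorem theorem2p2 (d cin cout : ℕ) (Ω : Set (GPO.E d)) (hΩ : IsCompact Ω)
    (p q : ℝ≥0∞) [Fact (1 ≤ p)] [Fact (1 ≤ q)]
    (T : Lp (GPO.E cin) p (volume.restrict Ω) → Lp (GPO.E cout) q (volume.restrict Ω))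
    (hT : ∀ S : Set (Lp (GPO.E cin) p (volume.restrict Ω)),
      Bornology.IsBounded S → ContinuousOn T S)
    (hK : GPO.HasContinuousKernel T ∨
      (2 ≤ p ∧ q ≤ 2 ∧ GPO.HasHilbertSchmidtKernel T) ∨
      GPO.HasLowRankFactorization T)
    (S : Set (Lp (GPO.E cin) p (volume.restrict Ω))) (hS : Bornology.IsBounded S)
    (hp : 1 < p ∨ TotallyBounded S)
    (ε : ℝ) (hε : 0 < ε) :
    ∃ (G : ℕ) (_ : 0 < G) (Θ : GPO.Params d cin cout G),
      (∀ f ∈ S, Θ.WellDefinedAt (volume.restrict Ω) f ∧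
        MemLp (Θ.eval (volume.restrict Ω) f) q (volume.restrict Ω)) ∧
      ⨆ f ∈ S, eLpNorm (fun x => Θ.eval (volume.restrict Ω) f x - T f x) q (volume.restrict Ω)
        < ENNReal.ofReal ε := by
  have hp1 : 1 ≤ p := Fact.out
  have := GPO.isFiniteMeasure_restrict hΩ
  obtain ⟨ι, hι, A, b, j, hA, hb, hsep⟩ :=
    GPO.exists_sepOp_approx hΩ T hK hS (by positivity : 0 < ε / 4)
  obtain ⟨C, hC0, hC⟩ := GPO.exists_eLpNorm_le_of_ae_bound (μ := volume.restrict Ω)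
    (F := GPO.E cout) q
  obtain ⟨R, hR⟩ := GPO.exists_eLpNorm_le_of_isBounded hS
  obtain ⟨L, hL0, hL⟩ := GPO.exists_integral_norm_le (μ := volume.restrict Ω) (F := GPO.E cin) hp1 R
  obtain ⟨Q, hQ⟩ := GPO.exists_channels_near_sepOp hΩ hA hb j
    (𝓕 := (fun f : Lp (GPO.E cin) p (volume.restrict Ω) => (f : GPO.E d → GPO.E cin)) '' S) hL0
    (by
      rintro _ ⟨f, -, rfl⟩
      exact memLp_one_iff_integrable.1 ((Lp.memLp f).mono_exponent hp1))
    (by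
      rintro _ ⟨f, hf, rfl⟩
      exact hL f (Lp.memLp f) (hR f hf))
    (fun δ hδ => by
      obtain ⟨M, hM, h⟩ := GPO.exists_tail_le hS hp hδ
      refine ⟨M, hM, ?_⟩
      rintro _ ⟨f, hf, rfl⟩
      exact h f hf)
    (by positivity : 0 < ε / 4 / (C + 1))
  have hmem : ∀ f ∈ S, MemLp (Q.params.eval (volume.restrict Ω) f) q (volume.restrict Ω) :=
    fun f _ => Q.memLp_eval_params (Lp.aestronglyMeasurable f) q
  refine ⟨Q.N + Q.N, Nat.add_pos_left Q.N_pos _, Q.params, fun f hf =>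
    ⟨Q.wellDefinedAt_params (Lp.aestronglyMeasurable f), hmem f hf⟩, ?_⟩
  refine lt_of_le_of_lt (iSup₂_le fun f hf => ?_)
    ((ENNReal.ofReal_lt_ofReal_iff hε).2 (half_lt_self hε))
  have hsm := GPO.aestronglyMeasurable_sepOp hΩ hA b j f
  have hsplit : (fun x => Q.params.eval (volume.restrict Ω) f x - T f x) =
      (fun x => Q.params.eval (volume.restrict Ω) f x - GPO.sepOp Ω A b j f x) -
      fun x => T f x - GPO.sepOp Ω A b j f x := by
    funext x
    simp
  have h1 : eLpNorm (fun x => Q.params.eval (volume.restrict Ω) f x - GPO.sepOp Ω A b j f x) q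
      (volume.restrict Ω) ≤ ENNReal.ofReal (ε / 4) := by
    refine (hC _ _ (ae_restrict_of_forall_mem hΩ.measurableSet
      (hQ f ⟨f, hf, rfl⟩))).trans (ENNReal.ofReal_le_ofReal ?_)
    rw [← mul_div_assoc, div_le_iff₀ (by positivity)]
    nlinarith
  rw [hsplit]
  refine (eLpNorm_sub_le ((hmem f hf).1.sub hsm) ((Lp.aestronglyMeasurable _).sub hsm)
    Fact.out).trans ((add_le_add h1 (hsep f hf)).trans (le_of_eq ?_))
  rw [← ENNReal.ofReal_add (by positivity) (by positivity)]
  congr 1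
  ring
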